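/- **Theorem 1.1.** Let $I\subseteq\mathbb R$ be an open interval with standard coordinate $t$, let $(F,g_F)$ be a smooth semi-Riemannian (in particular, Riemannian) manifold of dimension $n-1$ with $n\ge 4$, let $f>0$ be a smooth function on $I$ and $\epsilon\in\{1,-1\}$, and let $(M,g)=I\times_f F$ be the warped product $I\times F$ with the metric $g=\epsilon\,dt^2+f(t)^2g_F$. Let $U$ be the lift of $\partial_t$ to $M$ and $u=g(U,\cdot)$. Write $R$, $\mathrm{Ric}$, $r$ for the curvature tensor ($R(X,Y)Z=\nabla_X\nabla_YZ-\nabla_Y\nabla_XZ-\nabla_{[X,Y]}Z$), the Ricci tensor ($\mathrm{Ric}(Y,Z)=\operatorname{tr}(X\mapsto R(X,Y)Z)$) and the scalar curvature of $g$, and let $Q$ be the Ricci operator, $g(QX,Y)=\mathrm{Ric}(X,Y)$. The Weyl tensor $W$ is $$W(X,Y,Z)=R(X,Y)Z+\tfrac1{n-2}\big[\mathrm{Ric}(X,Z)Y-\mathrm{Ric}(Y,Z)X+g(X,Z)QY-g(Y,Z)QX\big]-\tfrac{r}{(n-1)(n-2)}\big[g(X,Z)Y-g(Y,Z)X\big],$$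 and $W_{abcd}=g(W(e_a,e_b,e_c),e_d)$. Suppose that at least one of the following holds: (i) $g_F$ is Einstein, that is, the Ricci tensor of $g_F$ is a constant multiple of $g_F$; (ii) $g(W(x,U,U),y)=0$ for all $x,y$ tangent to $F$; (iii) $f$ is not constant and the Weyl tensor of $g$ is harmonic, that is, $\nabla^dW_{abcd}=0$. Then $g$ is weakly conformally flat and quasi-Einstein, both with respect to the unit vector field $U$: $W(X,Y,U)=0$ for all $X,Y$, and there are smooth functions $a,b$ on $M$ with $\mathrm{Ric}=a\,g+b\,u\otimes u$. Moreover $g$ is Bach-flat: the tensor $$B_{ab}=\kappa\,\nabla^c\nabla^dW_{cabd}+\tfrac1{n-2}R^{cd}W_{cabd}$$ vanishes, where $R^{cd}$ are the components of the Ricci tensor, both for $\kappa=\tfrac1{n-3}$ (the usual normalization of the Bach tensor) and for $\kappa=\tfrac1{n-1}$. -/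

import Mathlib

open scoped Manifold ContDiff Topology

noncomputable section

/-! ### Tensor calculus of a metric in one coordinate domain

Here `E` is a finite-dimensional real vector space (the coordinate space), and
`G : E → E →L[ℝ] E →L[ℝ] ℝ` is a field of symmetric nondegenerate bilinear forms near the point at
which the tensors below are evaluated.  All arguments `u, v, w : E` are constant (coordinate)
vector fields.  The values outside the domain of smoothness and nondegeneracy are irrelevant. -/

namespace CoordGeom

variable {E : Type*} [NormedAddCommGroup E] [NormedSpace ℝ E] [FiniteDimensional ℝ E]

/-- The musical isomorphism `♯` at `x`: the inverse of `v ↦ G x v`. -/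
def sharp (G : E → E →L[ℝ] E →L[ℝ] ℝ) (x : E) : (E →L[ℝ] ℝ) →L[ℝ] E :=
  ContinuousLinearMap.inverse (G x)

/-- A basis of the coordinate space; only used to form traces. -/
def frame (E : Type*) [NormedAddCommGroup E] [NormedSpace ℝ E] [FiniteDimensional ℝ E] :
    Module.Basis (Fin (Module.finrank ℝ E)) ℝ E :=
  Module.finBasis ℝ E

/-- The dual basis of `frame E`. -/
def coframe (E : Type*) [NormedAddCommGroup E] [NormedSpace ℝ E] [FiniteDimensional ℝ E]
    (i : Fin (Module.finrank ℝ E)) : E →L[ℝ] ℝ :=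
  LinearMap.toContinuousLinearMap ((frame E).coord i)

/-- The metric trace `G^{ij} B(e_i, e_j)` of a bilinear form `B`. -/
def metricTrace (G : E → E →L[ℝ] E →L[ℝ] ℝ) (x : E) (B : E → E → ℝ) : ℝ :=
  ∑ i, B (frame E i) (sharp G x (coframe E i))

/-- The `1`-form `w ↦ ½ (∂_u G(v,w) + ∂_v G(u,w) - ∂_w G(u,v))`
(Christoffel symbols of the first kind). -/
def koszul (G : E → E →L[ℝ] E →L[ℝ] ℝ) (x u v : E) : E →L[ℝ] ℝ :=
  (1 / 2 : ℝ) • (fderiv ℝ G x u v + fderiv ℝ G x v u - ((fderiv ℝ G x).flip u).flip v)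

/-- Christoffel symbols of the Levi-Civita connection: `∇_u v` at `x` for the constant vector
fields `u` and `v`. -/
def christoffel (G : E → E →L[ℝ] E →L[ℝ] ℝ) (x u v : E) : E :=
  sharp G x (koszul G x u v)

/-- The curvature tensor `R(u,v)w = ∇_u ∇_v w - ∇_v ∇_u w` (the bracket of constant fields is
zero). -/
def riemann (G : E → E →L[ℝ] E →L[ℝ] ℝ) (x u v w : E) : E :=
  fderiv ℝ (fun y => christoffel G y v w) x u - fderiv ℝ (fun y => christoffel G y u w) x v
    + christoffel G x u (christoffel G x v w) - christoffel G x v (christoffel G x u w)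

/-- The Ricci tensor `Ric(v,w) = tr (u ↦ R(u,v)w)`. -/
def ricci (G : E → E →L[ℝ] E →L[ℝ] ℝ) (x v w : E) : ℝ :=
  ∑ i, coframe E i (riemann G x (frame E i) v w)

/-- The Ricci operator `Q`, `G(Q v, w) = Ric(v, w)`. -/
def ricciOp (G : E → E →L[ℝ] E →L[ℝ] ℝ) (x v : E) : E :=
  ∑ i, ricci G x v (frame E i) • sharp G x (coframe E i)

/-- The scalar curvature. -/
def scalar (G : E → E →L[ℝ] E →L[ℝ] ℝ) (x : E) : ℝ :=
  metricTrace G x (ricci G x)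

/-- The Weyl tensor of type `(1,3)`, `W(u,v,w) = W(u,v)w`. -/
def weyl (G : E → E →L[ℝ] E →L[ℝ] ℝ) (x u v w : E) : E :=
  let n : ℝ := Module.finrank ℝ E
  riemann G x u v w
    + (1 / (n - 2)) • (ricci G x u w • v - ricci G x v w • u
        + G x u w • ricciOp G x v - G x v w • ricciOp G x u)
    - (scalar G x / ((n - 1) * (n - 2))) • (G x u w • v - G x v w • u)

/-- The Weyl tensor of type `(0,4)`, `W_{abcd} = G(W(e_a,e_b)e_c, e_d)`. -/
def weylLow (G : E → E →L[ℝ] E →L[ℝ] ℝ) (x : E) (a : Fin 4 → E) : ℝ :=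
  G x (weyl G x (a 0) (a 1) (a 2)) (a 3)

/-- The covariant derivative of a covariant `k`-tensor field `T`; the direction of
differentiation is the new first argument. -/
def covDeriv (G : E → E →L[ℝ] E →L[ℝ] ℝ) {k : ℕ} (T : E → (Fin k → E) → ℝ) (x : E)
    (v : Fin (k + 1) → E) : ℝ :=
  fderiv ℝ (fun y => T y (Fin.tail v)) x (v 0)
    - ∑ i, T x (Function.update (Fin.tail v) i (christoffel G x (v 0) (Fin.tail v i)))

/-- The divergence `∇^d W_{abcd}` of the Weyl tensor. -/
def divWeyl (G : E → E →L[ℝ] E →L[ℝ] ℝ) (x a b c : E) : ℝ :=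
  metricTrace G x fun d' d => covDeriv G (weylLow G) x ![d', a, b, c, d]

/-- The Bach tensor `B_{ab} = κ ∇^c ∇^d W_{cabd} + 1/(n-2) R^{cd} W_{cabd}`, with a parameter `κ`
for the normalization of the first term. -/
def bach (κ : ℝ) (G : E → E →L[ℝ] E →L[ℝ] ℝ) (x a b : E) : ℝ :=
  let n : ℝ := Module.finrank ℝ E
  κ * (metricTrace G x fun c' c => metricTrace G x fun d' d =>
      covDeriv G (covDeriv G (weylLow G)) x ![c', d', c, a, b, d])
    + (1 / (n - 2)) * (metricTrace G x fun c' c => metricTrace G x fun d' d =>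
      ricci G x c' d' * weylLow G x ![c, a, b, d])

end CoordGeom

/-! ### Semi-Riemannian manifolds

For a manifold `M` without boundary, `TangentSpace I p` is the coordinate space `E`, a tangent
vector at `p` being represented by its components in the preferred chart at `p`.  The tensors at
`p` are computed in that chart. -/

namespace SemiRiem

section General

variable {E : Type*} [NormedAddCommGroup E] [NormedSpace ℝ E]
  {H : Type*} [TopologicalSpace H] {M : Type*} [TopologicalSpace M] [ChartedSpace H M]

/-- A field of bilinear forms on the tangent spaces of `M`. -/
abbrev BilinField (I : ModelWithCorners ℝ E H) (M : Type*) [TopologicalSpace M]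
    [ChartedSpace H M] : Type _ :=
  ∀ p : M, TangentSpace I p →L[ℝ] TangentSpace I p →L[ℝ] ℝ

variable {I : ModelWithCorners ℝ E H}

/-- A bilinear form on `TangentSpace I p`, seen as a bilinear form on `E` (the two spaces are equal
by definition). -/
def modelForm {p : M} (B : TangentSpace I p →L[ℝ] TangentSpace I p →L[ℝ] ℝ) :
    E →L[ℝ] E →L[ℝ] ℝ :=
  B

/-- The derivative at `y` of the inverse of the preferred chart at `p`. -/
def chartInvDeriv (I : ModelWithCorners ℝ E H) (p : M) (y : E) : E →L[ℝ] E :=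
  mfderiv 𝓘(ℝ, E) I (extChartAt I p).symm y

/-- The field `g` in the preferred chart at `p`: its pull-back by the inverse of that chart. -/
def inChart (g : BilinField I M) (p : M) (y : E) : E →L[ℝ] E →L[ℝ] ℝ :=
  (modelForm (g ((extChartAt I p).symm y))).bilinearComp (chartInvDeriv I p y) (chartInvDeriv I p y)

/-- `g` is a (smooth) semi-Riemannian metric. -/
structure IsSemiRiemannianMetric (g : BilinField I M) : Prop where
  symm : ∀ p v w, g p v w = g p w v
  nondegenerate : ∀ p v, (∀ w, g p v w = 0) → v = 0
  smooth : ∀ p, ContDiffOn ℝ ∞ (inChart g p) (extChartAt I p).target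

/-- A smooth vector field. -/
def IsSmoothField [IsManifold I 1 M] (V : ∀ p : M, TangentSpace I p) : Prop :=
  ContMDiff I I.tangent ∞ fun p => (⟨p, V p⟩ : TangentBundle I M)

variable [FiniteDimensional ℝ E]

/-- The Ricci tensor at `p`. -/
def ricciAt (g : BilinField I M) (p : M) (v w : TangentSpace I p) : ℝ :=
  CoordGeom.ricci (E := E) (inChart g p) (extChartAt I p p) v w

/-- The `(1,3)` Weyl tensor at `p`. -/
def weylAt (g : BilinField I M) (p : M) (u v w : TangentSpace I p) : TangentSpace I p :=
  (CoordGeom.weyl (E := E) (inChart g p) (extChartAt I p p) u v w : E)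

/-- The divergence `∇^d W_{abcd}` of the Weyl tensor at `p`. -/
def divWeylAt (g : BilinField I M) (p : M) (a b c : TangentSpace I p) : ℝ :=
  CoordGeom.divWeyl (E := E) (inChart g p) (extChartAt I p p) a b c

/-- The Bach tensor at `p`, with coefficient `κ` in front of the second derivatives. -/
def bachAt (κ : ℝ) (g : BilinField I M) (p : M) (a b : TangentSpace I p) : ℝ :=
  CoordGeom.bach (E := E) κ (inChart g p) (extChartAt I p p) a b

/-- `g` is Einstein: `Ric = Λ g` with a constant `Λ`. -/
def IsEinstein (g : BilinField I M) : Prop :=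
  ∃ Λ : ℝ, ∀ p v w, ricciAt g p v w = Λ * g p v w

/-- The Weyl tensor of `g` is harmonic (divergence-free). -/
def HasHarmonicWeyl (g : BilinField I M) : Prop :=
  ∀ p a b c, divWeylAt g p a b c = 0

/-- The Bach tensor of `g` (with coefficient `κ`) vanishes. -/
def IsBachFlat (κ : ℝ) (g : BilinField I M) : Prop :=
  ∀ p a b, bachAt κ g p a b = 0

/-- `g` is weakly conformally flat with respect to the non-zero vector field `V`:
`W(X,Y,V) = 0` for all `X, Y`. -/
def IsWeaklyConformallyFlatWith [IsManifold I 1 M] (g : BilinField I M)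
    (V : ∀ p : M, TangentSpace I p) : Prop :=
  IsSmoothField V ∧ (∀ p, V p ≠ 0) ∧ ∀ p u v, weylAt g p u v (V p) = 0

/-- `g` is quasi-Einstein with respect to the unit vector field `U`: `Ric = a g + b u ⊗ u` with
smooth functions `a, b` and `u = g(U, ·)`. -/
def IsQuasiEinsteinWith [IsManifold I 1 M] (g : BilinField I M)
    (U : ∀ p : M, TangentSpace I p) : Prop :=
  IsSmoothField U ∧ ((∀ p, g p (U p) (U p) = 1) ∨ ∀ p, g p (U p) (U p) = -1) ∧
    ∃ a b : M → ℝ, ContMDiff I 𝓘(ℝ, ℝ) ∞ a ∧ ContMDiff I 𝓘(ℝ, ℝ) ∞ b ∧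
      ∀ p v w, ricciAt g p v w = a p * g p v w + b p * (g p (U p) v * g p (U p) w)

end General

section Warped

variable {E : Type*} [NormedAddCommGroup E] [NormedSpace ℝ E]
  {F : Type*} [TopologicalSpace F] [ChartedSpace E F]

/-- The warped product metric `ε dt² + f(t)² g_F` on `J × F`, for an open `J ⊆ ℝ`.  The tangent
space of `J × F` at `q` is `ℝ × T_{q.2} F`, so that the value on `v, w` is
`ε * (v.1 * w.1) + f(q.1) ^ 2 * g_F (v.2, w.2)`. -/
def warpedMetric (J : TopologicalSpace.Opens ℝ) (ε : ℝ) (f : ℝ → ℝ) (gF : BilinField 𝓘(ℝ, E) F) :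
    BilinField (𝓘(ℝ, ℝ).prod 𝓘(ℝ, E)) (J × F) := fun q =>
  let G : ℝ × E →L[ℝ] ℝ × E →L[ℝ] ℝ :=
    ε • (ContinuousLinearMap.mul ℝ ℝ).bilinearComp
        (ContinuousLinearMap.fst ℝ ℝ E) (ContinuousLinearMap.fst ℝ ℝ E)
      + (f q.1) ^ 2 • (modelForm (gF q.2)).bilinearComp
        (ContinuousLinearMap.snd ℝ ℝ E) (ContinuousLinearMap.snd ℝ ℝ E)
  G

/-- The lift to `J × F` of the coordinate field `∂_t` of `J`. -/
def liftDt (J : TopologicalSpace.Opens ℝ) (F : Type*) [TopologicalSpace F] [ChartedSpace E F]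
    (q : J × F) : TangentSpace (𝓘(ℝ, ℝ).prod 𝓘(ℝ, E)) q :=
  ((1, 0) : ℝ × E)

/-- The vector at `q` tangent to the fibre through `q` that projects to `x ∈ T_{q.2} F`. -/
def liftFiber (J : TopologicalSpace.Opens ℝ) (q : J × F) (x : TangentSpace 𝓘(ℝ, E) q.2) :
    TangentSpace (𝓘(ℝ, ℝ).prod 𝓘(ℝ, E)) q :=
  ((0, x) : ℝ × E)

/-- The electric part of the Weyl tensor of the warped product vanishes: `g(W(x,U,U),y) = 0` for
`x, y` tangent to the fibres and `U` the lift of `∂_t`. -/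
def ElectricPartVanishes (J : TopologicalSpace.Opens ℝ) (ε : ℝ) (f : ℝ → ℝ)
    (gF : BilinField 𝓘(ℝ, E) F) [FiniteDimensional ℝ E] : Prop :=
  ∀ (q : J × F) (x y : TangentSpace 𝓘(ℝ, E) q.2),
    warpedMetric J ε f gF q
      (weylAt (warpedMetric J ε f gF) q (liftFiber J q x) (liftDt J F q) (liftDt J F q))
      (liftFiber J q y) = 0

end Warped

end SemiRiem

end

/-! Let m = n − 1 ≥ 3 be the dimension of the fibre and Z its trace-free Ricci tensor. With ds =
dt/f the metric is f²(ε ds² + g_F), so by conformal invariance its Weyl tensor is, up to the factor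
f², that of a product. In terms of dt it is the fibre part f² `cylWeyl` plus a Kulkarni–Nomizu type
product of dt² with Z, of coefficient ±ε/(m − 1). This is `weylLow_eq`, obtained by direct
computation; every derivative of f cancels.

Each hypothesis forces Z = 0. For an Einstein fibre this is the definition. The electric part of W
is −ε/(m − 1) Z. The component of div W at (∂_t, v, w) is (2 − m)/(m − 1) · (f'/f) · Z(v, w)
(`divWeyl_eq`), and a single t with f'(t) ≠ 0 settles all points of the fibre, because Z does not
depend on t.

Conversely, let Z = 0, so that the fibre is Einstein with a pointwise factor r. Schur's lemma (m ≥
3) makes r locally constant, hence the two coefficients of the quasi-Einstein decomposition are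
smooth. Now W = f² `cylWeyl` has only fibre components, so it annihilates ∂_t, and Ric is a
combination of g and dt². The divergence of W vanishes: the contracted Bianchi identity makes the
curvature of the fibre divergence-free, and the other terms are traces of `cylWeyl`, which are zero.
Consequently the second-derivative term of the Bach tensor is the derivative of a zero tensor. The
algebraic term vanishes because W is trace-free and annihilates ∂_t. The two terms vanish
separately, so the normalization κ plays no role.

On the manifold, tensors at p are defined through the preferred chart at p. A product chart shows
the warped form at all of its points; only the Ricci tensor of the fibre has to be moved between
charts, by its naturality (`IsPullbackOn.ricci_eq`). -/

noncomputable section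

set_option maxSynthPendingDepth 3
set_option linter.unusedSectionVars false

/-! ### Metrics on a coordinate domain and the musical isomorphism -/

namespace CoordGeom

variable {V : Type*} [NormedAddCommGroup V] [NormedSpace ℝ V] [FiniteDimensional ℝ V]

/-- `G` is a smooth field of symmetric nondegenerate bilinear forms on the open set `Ω`. -/
structure IsMetricOn (G : V → V →L[ℝ] V →L[ℝ] ℝ) (Ω : Set V) : Prop where
  isOpen : IsOpen Ω
  smooth : ContDiffOn ℝ ∞ G Ω
  symm : ∀ x ∈ Ω, ∀ v w, G x v w = G x w v
  nondegenerate : ∀ x ∈ Ω, ∀ v, (∀ w, G x v w = 0) → v = 0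

/-- Injectivity plus equality of dimensions. `ContinuousLinearMap.inverse` has its intended value,
and is smooth, only at maps that come from an equivalence. -/
theorem exists_musical (B : V →L[ℝ] V →L[ℝ] ℝ) (hB : ∀ v, (∀ w, B v w = 0) → v = 0) :
    ∃ e : V ≃L[ℝ] (V →L[ℝ] ℝ), (e : V →L[ℝ] V →L[ℝ] ℝ) = B := by
  have hinj : Function.Injective (B : V →ₗ[ℝ] V →L[ℝ] ℝ) := by
    rw [injective_iff_map_eq_zero]
    intro v hv
    refine hB v fun w => ?_
    have : B v = 0 := hv
    simp [this]
  have hfin : Module.finrank ℝ V = Module.finrank ℝ (V →L[ℝ] ℝ) := by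
    rw [← LinearEquiv.finrank_eq (LinearMap.toContinuousLinearMap : (V →ₗ[ℝ] ℝ) ≃ₗ[ℝ] _)]
    exact (Subspace.dual_finrank_eq).symm
  refine ⟨(LinearMap.linearEquivOfInjective (B : V →ₗ[ℝ] V →L[ℝ] ℝ) hinj
    hfin).toContinuousLinearEquiv, ?_⟩
  ext v w
  simp

/-- The side condition for the symmetry of second derivatives of smooth maps. -/
theorem minSmoothness_two_le_infty : minSmoothness ℝ 2 ≤ ∞ := by
  rw [minSmoothness_of_isRCLikeNormedField]
  exact WithTop.coe_le_coe.2 (le_top : (2 : ℕ∞) ≤ ⊤)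

section sharp

variable {G : V → V →L[ℝ] V →L[ℝ] ℝ} {Ω : Set V} {x : V}

theorem flat_sharp (hG : IsMetricOn G Ω) (hx : x ∈ Ω) (α : V →L[ℝ] ℝ) :
    G x (sharp G x α) = α := by
  obtain ⟨e, he⟩ := exists_musical (G x) (hG.nondegenerate x hx)
  rw [sharp, ← he, ContinuousLinearMap.inverse_equiv]
  simp

theorem flat_sharp_apply (hG : IsMetricOn G Ω) (hx : x ∈ Ω) (α : V →L[ℝ] ℝ) (w : V) :
    G x (sharp G x α) w = α w := by rw [flat_sharp hG hx]

theorem flat_sharp_apply' (hG : IsMetricOn G Ω) (hx : x ∈ Ω) (α : V →L[ℝ] ℝ) (w : V) :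
    G x w (sharp G x α) = α w := by rw [hG.symm x hx, flat_sharp hG hx]

theorem eq_of_forall_inner (hG : IsMetricOn G Ω) (hx : x ∈ Ω) {v w : V}
    (h : ∀ z, G x v z = G x w z) : v = w := by
  rw [← sub_eq_zero]
  refine hG.nondegenerate x hx _ fun z => ?_
  simp [h z]

theorem contDiffOn_sharp (hG : IsMetricOn G Ω) : ContDiffOn ℝ ∞ (sharp G) Ω := by
  intro x hx
  obtain ⟨e, he⟩ := exists_musical (G x) (hG.nondegenerate x hx)
  have h1 : ContDiffAt ℝ ∞ ContinuousLinearMap.inverse (G x) := by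
    rw [← he]; exact contDiffAt_map_inverse e
  exact h1.comp_contDiffWithinAt x (hG.smooth x hx)

theorem differentiableAt_metric (hG : IsMetricOn G Ω) (hx : x ∈ Ω) : DifferentiableAt ℝ G x :=
  (hG.smooth.differentiableOn (by simp)).differentiableAt (hG.isOpen.mem_nhds hx)

theorem contDiffOn_fderiv_of {W : Type*} [NormedAddCommGroup W] [NormedSpace ℝ W] {φ : V → W}
    (hΩ : IsOpen Ω) (hφ : ContDiffOn ℝ ∞ φ Ω) : ContDiffOn ℝ ∞ (fderiv ℝ φ) Ω :=
  hφ.fderiv_of_isOpen hΩ (by simp)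

/-- Derivative of the symmetry identity. The identity holds on the open set Ω, hence near x, so both
sides have the same derivative at x; tensor identities are differentiated in this way throughout. -/
theorem fderiv_metric_symm (hG : IsMetricOn G Ω) (hx : x ∈ Ω) (u v w : V) :
    fderiv ℝ G x u v w = fderiv ℝ G x u w v := by
  have hd := differentiableAt_metric hG hx
  have key : ∀ a b : V, fderiv ℝ (fun y => G y a b) x u = fderiv ℝ G x u a b := by
    intro a b
    have h := ((hd.hasFDerivAt.clm_apply (hasFDerivAt_const a x)).clm_apply
      (hasFDerivAt_const b x))
    rw [h.fderiv]
    simp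
  rw [← key, ← key]
  have : (fun y => G y v w) =ᶠ[𝓝 x] fun y => G y w v := by
    filter_upwards [hG.isOpen.mem_nhds hx] with y hy using hG.symm y hy v w
  rw [this.fderiv_eq]

end sharp

/-! ### The Levi-Civita connection and the curvature tensor -/

section connection

variable (G : V → V →L[ℝ] V →L[ℝ] ℝ) {Ω : Set V} {x : V}

/-- `koszul`, bundled. -/
def koszulL (x : V) : V →L[ℝ] V →L[ℝ] V →L[ℝ] ℝ :=
  (1 / 2 : ℝ) • (fderiv ℝ G x + (fderiv ℝ G x).flip
    - ((ContinuousLinearMap.flipₗᵢ ℝ V V ℝ).toContinuousLinearEquiv :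
        (V →L[ℝ] V →L[ℝ] ℝ) →L[ℝ] (V →L[ℝ] V →L[ℝ] ℝ)) ∘L (fderiv ℝ G x).flip)

/-- The Christoffel symbols, bundled: `chr G x u` is the endomorphism `v ↦ ∇_u v`. -/
def chr (x : V) : V →L[ℝ] V →L[ℝ] V :=
  (ContinuousLinearMap.compL ℝ V (V →L[ℝ] ℝ) V (sharp G x)) ∘L koszulL G x

theorem koszulL_apply (x u v : V) : koszulL G x u v = koszul G x u v := by
  ext w
  simp [koszulL, koszul]

theorem chr_apply (x u v : V) : chr G x u v = christoffel G x u v := by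
  simp [chr, christoffel, koszulL_apply]

variable {G}

theorem chr_symm (hG : IsMetricOn G Ω) (hx : x ∈ Ω) (u v : V) : chr G x u v = chr G x v u := by
  rw [chr_apply, chr_apply, christoffel, christoffel]
  congr 1
  ext w
  simp only [koszul, smul_apply, add_apply,
    sub_apply, ContinuousLinearMap.flip_apply]
  rw [fderiv_metric_symm hG hx w u v]
  ring

theorem inner_chr (hG : IsMetricOn G Ω) (hx : x ∈ Ω) (u v w : V) :
    G x (chr G x u v) w =
      (1 / 2) * (fderiv ℝ G x u v w + fderiv ℝ G x v u w - fderiv ℝ G x w u v) := by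
  rw [chr_apply, christoffel, flat_sharp_apply hG hx]
  simp [koszul]

/-- The Levi-Civita connection is metric. -/
theorem fderiv_metric (hG : IsMetricOn G Ω) (hx : x ∈ Ω) (u v w : V) :
    fderiv ℝ G x u v w = G x (chr G x u v) w + G x v (chr G x u w) := by
  rw [hG.symm x hx v, inner_chr hG hx, inner_chr hG hx]
  linarith [fderiv_metric_symm hG hx w v u, fderiv_metric_symm hG hx v w u,
    fderiv_metric_symm hG hx u w v]

/-- A symmetric metric connection is the Levi-Civita connection. -/
theorem christoffel_unique (hG : IsMetricOn G Ω) (hx : x ∈ Ω) (C : V → V → V)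
    (hs : ∀ u v, C u v = C v u)
    (hm : ∀ u v w, fderiv ℝ G x u v w = G x (C u v) w + G x v (C u w)) (u v : V) :
    christoffel G x u v = C u v := by
  rw [← chr_apply]
  refine eq_of_forall_inner hG hx fun w => ?_
  rw [inner_chr hG hx, hm u v w, hm v u w, hm w u v, hs v u, hs w u, hs w v,
    hG.symm x hx (C u w) v, hG.symm x hx u]
  ring

theorem contDiffOn_chr (hG : IsMetricOn G Ω) : ContDiffOn ℝ ∞ (chr G) Ω := by
  have hD := contDiffOn_fderiv_of hG.isOpen hG.smooth
  have hS := contDiffOn_sharp hG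
  rw [contDiffOn_clm_apply]
  intro u
  rw [contDiffOn_clm_apply]
  intro v
  have : ContDiffOn ℝ ∞ (fun x => koszul G x u v) Ω := by
    rw [contDiffOn_clm_apply]
    intro w
    simp only [koszul, smul_apply, add_apply,
      sub_apply, ContinuousLinearMap.flip_apply]
    fun_prop
  simp only [chr_apply, christoffel]
  exact hS.clm_apply this

theorem differentiableAt_chr (hG : IsMetricOn G Ω) (hx : x ∈ Ω) : DifferentiableAt ℝ (chr G) x :=
  ((contDiffOn_chr hG).differentiableOn (by simp)).differentiableAt (hG.isOpen.mem_nhds hx)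

variable (G)

/-- The curvature tensor, bundled. -/
def riem (x : V) : V →L[ℝ] V →L[ℝ] V →L[ℝ] V :=
  fderiv ℝ (chr G) x - (fderiv ℝ (chr G) x).flip
    + (ContinuousLinearMap.compL ℝ V V V).bilinearComp (chr G x) (chr G x)
    - ((ContinuousLinearMap.compL ℝ V V V).bilinearComp (chr G x) (chr G x)).flip

theorem riem_apply (x u v : V) : riem G x u v = fderiv ℝ (chr G) x u v - fderiv ℝ (chr G) x v u
    + chr G x u ∘L chr G x v - chr G x v ∘L chr G x u := by
  simp [riem]

variable {G}

theorem fderiv_christoffel (hG : IsMetricOn G Ω) (hx : x ∈ Ω) (u v w : V) :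
    fderiv ℝ (fun y => christoffel G y v w) x u = fderiv ℝ (chr G) x u v w := by
  simp only [← chr_apply]
  rw [(((differentiableAt_chr hG hx).hasFDerivAt.clm_apply (hasFDerivAt_const v x)).clm_apply
      (hasFDerivAt_const w x)).fderiv]
  simp

/-- Valid on Ω, where the Christoffel symbols are differentiable, so that differentiation commutes
with evaluation on constant vectors. -/
theorem riemann_eq_riem (hG : IsMetricOn G Ω) (hx : x ∈ Ω) (u v w : V) :
    riemann G x u v w = riem G x u v w := by
  rw [riemann, fderiv_christoffel hG hx, fderiv_christoffel hG hx, riem_apply]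
  simp [chr_apply]

theorem contDiffOn_riem (hG : IsMetricOn G Ω) : ContDiffOn ℝ ∞ (riem G) Ω := by
  have h1 := contDiffOn_chr hG
  have h2 := contDiffOn_fderiv_of hG.isOpen h1
  rw [contDiffOn_clm_apply]
  intro u
  rw [contDiffOn_clm_apply]
  intro v
  simp only [riem_apply]
  have hu : ContDiffOn ℝ ∞ (fun x => chr G x u) Ω := by fun_prop
  have hv : ContDiffOn ℝ ∞ (fun x => chr G x v) Ω := by fun_prop
  exact ((((h2.clm_apply contDiffOn_const).clm_apply contDiffOn_const).sub
    ((h2.clm_apply contDiffOn_const).clm_apply contDiffOn_const)).add (hu.clm_comp hv)).sub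
    (hv.clm_comp hu)

theorem differentiableAt_riem (hG : IsMetricOn G Ω) (hx : x ∈ Ω) : DifferentiableAt ℝ (riem G) x :=
  ((contDiffOn_riem hG).differentiableOn (by simp)).differentiableAt (hG.isOpen.mem_nhds hx)

theorem riem_antisymm (x u v : V) : riem G x u v = - riem G x v u := by
  rw [riem_apply, riem_apply]; abel

/-- The endomorphisms `R(u,v)` are skew-adjoint. -/
theorem inner_riem_antisymm (hG : IsMetricOn G Ω) (hx : x ∈ Ω) (u v w z : V) :
    G x (riem G x u v w) z = - G x (riem G x u v z) w := by
  have hd := differentiableAt_metric hG hx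
  have hc := differentiableAt_chr hG hx
  -- second derivatives of the metric, from the derivative of the compatibility equation
  have key : ∀ a b : V, fderiv ℝ (fderiv ℝ G) x a b w z =
      G x (chr G x a (chr G x b w)) z + G x (chr G x b w) (chr G x a z)
      + G x (fderiv ℝ (chr G) x a b w) z + G x (chr G x a w) (chr G x b z)
      + G x w (chr G x a (chr G x b z)) + G x w (fderiv ℝ (chr G) x a b z) := by
    intro a b
    have hdd : DifferentiableAt ℝ (fderiv ℝ G) x :=
      ((contDiffOn_fderiv_of hG.isOpen hG.smooth).differentiableOn (by simp)).differentiableAt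
        (hG.isOpen.mem_nhds hx)
    have e1 := ((((hdd.hasFDerivAt.clm_apply (hasFDerivAt_const b x)).clm_apply
      (hasFDerivAt_const w x))).clm_apply (hasFDerivAt_const z x))
    have e2 : (fun y => fderiv ℝ G y b w z) =ᶠ[𝓝 x]
        fun y => G y (chr G y b w) z + G y w (chr G y b z) := by
      filter_upwards [hG.isOpen.mem_nhds hx] with y hy using fderiv_metric hG hy b w z
    have c : ∀ w, HasFDerivAt (fun y => chr G y b w) _ x := fun w =>
      ((hc.hasFDerivAt.clm_apply (hasFDerivAt_const b x)).clm_apply (hasFDerivAt_const w x))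
    have e3 := ((hd.hasFDerivAt.clm_apply (c w)).clm_apply (hasFDerivAt_const z x)).add
      ((hd.hasFDerivAt.clm_apply (hasFDerivAt_const w x)).clm_apply (c z))
    have e4 := congrArg (fun L => L a) ((e1.congr_of_eventuallyEq e2.symm).unique e3)
    simp only [add_apply, ContinuousLinearMap.comp_apply,
      ContinuousLinearMap.flip_apply, zero_apply, map_zero, zero_add,
      add_zero, fderiv_metric hG hx] at e4
    rw [e4]
    ring
  have hsymm : fderiv ℝ (fderiv ℝ G) x u v = fderiv ℝ (fderiv ℝ G) x v u :=
    ((hG.smooth.contDiffAt (hG.isOpen.mem_nhds hx)).isSymmSndFDerivAt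
      minSmoothness_two_le_infty).eq u v
  -- Antisymmetrizing `key` in u, v removes the second derivative of G and the mixed products G(∇_u
  -- w, ∇_v z); what is left is G(R(u,v)w, z) + G(w, R(u,v)z) = 0.
  have h := (key u v).symm.trans ((congrArg (fun L => L w z) hsymm).trans (key v u))
  simp only [riem_apply, add_apply, sub_apply,
    ContinuousLinearMap.comp_apply, map_add, map_sub]
  simp only [hG.symm x hx _ w]
  linarith

end connection

/-! ### Traces of endomorphisms and metric traces of bilinear forms -/

section trace

variable {ι : Type*} [Fintype ι]

theorem sum_coframe_apply (T : V →ₗ[ℝ] V) :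
    ∑ i, coframe V i (T (frame V i)) = LinearMap.trace ℝ V T := by
  rw [LinearMap.trace_eq_matrix_trace ℝ (frame V), Matrix.trace]
  simp [LinearMap.toMatrix_apply, coframe]

theorem sum_coord_apply [DecidableEq ι] (b : Module.Basis ι ℝ V) (T : V →ₗ[ℝ] V) :
    ∑ i, b.coord i (T (b i)) = LinearMap.trace ℝ V T := by
  rw [LinearMap.trace_eq_matrix_trace ℝ b, Matrix.trace]
  simp [LinearMap.toMatrix_apply]

theorem sum_coframe_smul (v : V) : ∑ i, coframe V i v • frame V i = v :=
  (frame V).sum_repr v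

theorem sum_apply_smul_coframe (α : V →L[ℝ] ℝ) : ∑ i, α (frame V i) • coframe V i = α := by
  ext v
  conv_rhs => rw [← sum_coframe_smul v]
  simp [mul_comm]

theorem coframe_frame (i j : Fin (Module.finrank ℝ V)) :
    coframe V i (frame V j) = if j = i then 1 else 0 := by
  simp [coframe, Finsupp.single_apply]

/-- Bilinearity of an unbundled function of two vectors. -/
structure IsBilin (B : V → V → ℝ) : Prop where
  add_left : ∀ u v w, B (u + v) w = B u w + B v w
  smul_left : ∀ (c : ℝ) u w, B (c • u) w = c * B u w
  add_right : ∀ u v w, B u (v + w) = B u v + B u w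
  smul_right : ∀ (c : ℝ) u w, B u (c • w) = c * B u w

theorem isBilin_clm (B : V →L[ℝ] V →L[ℝ] ℝ) : IsBilin fun v w => B v w := by
  constructor <;> intros <;> simp

theorem IsBilin.sum_left {B : V → V → ℝ} (hB : IsBilin B) (s : Finset ι) (c : ι → ℝ) (v : ι → V)
    (w : V) : B (∑ i ∈ s, c i • v i) w = ∑ i ∈ s, c i * B (v i) w := by
  classical
  induction s using Finset.induction_on with
  | empty => simpa using hB.smul_left 0 0 w
  | insert a s ha ih => rw [Finset.sum_insert ha, Finset.sum_insert ha, hB.add_left, ih,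
      hB.smul_left]

theorem IsBilin.sum_right {B : V → V → ℝ} (hB : IsBilin B) (s : Finset ι) (c : ι → ℝ) (v : ι → V)
    (w : V) : B w (∑ i ∈ s, c i • v i) = ∑ i ∈ s, c i * B w (v i) := by
  classical
  induction s using Finset.induction_on with
  | empty => simpa using hB.smul_right 0 w 0
  | insert a s ha ih => rw [Finset.sum_insert ha, Finset.sum_insert ha, hB.add_right, ih,
      hB.smul_right]

/-- The metric trace can be computed in any basis. -/
theorem metricTrace_eq_sum (G : V → V →L[ℝ] V →L[ℝ] ℝ) (x : V) {B : V → V → ℝ} (hB : IsBilin B)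
    (b : Module.Basis ι ℝ V) :
    metricTrace G x B = ∑ k, B (b k) (sharp G x (LinearMap.toContinuousLinearMap (b.coord k))) := by
  have h1 : ∀ i, B (frame V i) (sharp G x (coframe V i)) =
      ∑ k, b.coord k (frame V i) * B (b k) (sharp G x (coframe V i)) := by
    intro i
    rw [← hB.sum_left Finset.univ]
    congr 1
    exact (b.sum_repr _).symm
  have h2 : ∀ k, sharp G x (LinearMap.toContinuousLinearMap (b.coord k)) =
      ∑ i, b.coord k (frame V i) • sharp G x (coframe V i) := by
    intro k
    conv_lhs => rw [← sum_apply_smul_coframe (LinearMap.toContinuousLinearMap (b.coord k))]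
    simp
  simp only [metricTrace, h1, h2, hB.sum_right Finset.univ]
  exact Finset.sum_comm

theorem metricTrace_congr {G : V → V →L[ℝ] V →L[ℝ] ℝ} {x : V} {B C : V → V → ℝ}
    (h : ∀ v w, B v w = C v w) : metricTrace G x B = metricTrace G x C := by
  simp [metricTrace, h]

/-- The metric trace of `(v, w) ↦ G(T v, w)` is the trace of `T`. -/
theorem metricTrace_inner {G : V → V →L[ℝ] V →L[ℝ] ℝ} {Ω : Set V} {x : V}
    (hG : IsMetricOn G Ω) (hx : x ∈ Ω) (T : V →ₗ[ℝ] V) :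
    metricTrace G x (fun v w => G x (T v) w) = LinearMap.trace ℝ V T := by
  simp only [metricTrace, flat_sharp_apply' hG hx]
  exact sum_coframe_apply T

end trace

end CoordGeom

/-! ### The Ricci tensor and the Bianchi identities -/

namespace CoordGeom

variable {V : Type*} [NormedAddCommGroup V] [NormedSpace ℝ V] [FiniteDimensional ℝ V]
variable {G : V → V →L[ℝ] V →L[ℝ] ℝ} {Ω : Set V} {x : V}

theorem ricci_eq_sum (hG : IsMetricOn G Ω) (hx : x ∈ Ω) (v w : V) :
    ricci G x v w = ∑ i, coframe V i (riem G x (frame V i) v w) := by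
  simp only [ricci, riemann_eq_riem hG hx]

/-- The frame-free form is what permits conjugation by a linear isomorphism and a basis adapted to a
product. -/
theorem ricci_eq_trace (hG : IsMetricOn G Ω) (hx : x ∈ Ω) (v w : V) :
    ricci G x v w = LinearMap.trace ℝ V (((riem G x).flip v).flip w : V →L[ℝ] V) := by
  rw [ricci_eq_sum hG hx, ← sum_coframe_apply]
  rfl

theorem isBilin_ricci (hG : IsMetricOn G Ω) (hx : x ∈ Ω) : IsBilin (ricci G x) := by
  constructor <;> intros <;>
    simp [ricci_eq_sum hG hx, Finset.sum_add_distrib, Finset.mul_sum]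

theorem contDiffOn_ricci (hG : IsMetricOn G Ω) (v w : V) :
    ContDiffOn ℝ ∞ (fun x => ricci G x v w) Ω := by
  have h := contDiffOn_riem hG
  refine ContDiffOn.congr (f := fun x => ∑ i, coframe V i (riem G x (frame V i) v w)) ?_
    fun x hx => ricci_eq_sum hG hx v w
  fun_prop

variable (G) in
/-- The covariant derivative of the curvature tensor: `∇_e R (u, v)` as an endomorphism. -/
def nablaRiem (x e u v : V) : V →L[ℝ] V :=
  fderiv ℝ (riem G) x e u v + chr G x e ∘L riem G x u v - riem G x u v ∘L chr G x e
    - riem G x (chr G x e u) v - riem G x u (chr G x e v)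

theorem hasFDerivAt_riem_apply (hG : IsMetricOn G Ω) (hx : x ∈ Ω) (u v w : V) :
    HasFDerivAt (fun y => riem G y u v w)
      ((((fderiv ℝ (riem G) x).flip u).flip v).flip w) x := by
  have h := ((((differentiableAt_riem hG hx).hasFDerivAt.clm_apply
    (hasFDerivAt_const u x)).clm_apply (hasFDerivAt_const v x)).clm_apply (hasFDerivAt_const w x))
  refine h.congr_fderiv ?_
  ext e
  simp

theorem hasFDerivAt_chr_apply (hG : IsMetricOn G Ω) (hx : x ∈ Ω) (u v : V) :
    HasFDerivAt (fun y => chr G y u v) (((fderiv ℝ (chr G) x).flip u).flip v) x := by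
  have h := (((differentiableAt_chr hG hx).hasFDerivAt.clm_apply
    (hasFDerivAt_const u x)).clm_apply (hasFDerivAt_const v x))
  refine h.congr_fderiv ?_
  ext e
  simp

theorem hasFDerivAt_metric_apply (hG : IsMetricOn G Ω) (hx : x ∈ Ω) (u v : V) :
    HasFDerivAt (fun y => G y u v) (((fderiv ℝ G x).flip u).flip v) x := by
  have h := (((differentiableAt_metric hG hx).hasFDerivAt.clm_apply
    (hasFDerivAt_const u x)).clm_apply (hasFDerivAt_const v x))
  refine h.congr_fderiv ?_
  ext e
  simp

theorem fderiv_riem (hG : IsMetricOn G Ω) (hx : x ∈ Ω) (e u v : V) :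
    fderiv ℝ (riem G) x e u v =
      fderiv ℝ (fderiv ℝ (chr G)) x e u v - fderiv ℝ (fderiv ℝ (chr G)) x e v u
      + fderiv ℝ (chr G) x e u ∘L chr G x v + chr G x u ∘L fderiv ℝ (chr G) x e v
      - fderiv ℝ (chr G) x e v ∘L chr G x u - chr G x v ∘L fderiv ℝ (chr G) x e u := by
  have hdd : DifferentiableAt ℝ (fderiv ℝ (chr G)) x :=
    ((contDiffOn_fderiv_of hG.isOpen (contDiffOn_chr hG)).differentiableOn
      (by simp)).differentiableAt (hG.isOpen.mem_nhds hx)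
  have hc := (differentiableAt_chr hG hx).hasFDerivAt
  have d : ∀ u v : V, HasFDerivAt (fun y => fderiv ℝ (chr G) y u v) _ x := fun u v =>
    (hdd.hasFDerivAt.clm_apply (hasFDerivAt_const u x)).clm_apply (hasFDerivAt_const v x)
  have c : ∀ u : V, HasFDerivAt (fun y => chr G y u) _ x := fun u =>
    hc.clm_apply (hasFDerivAt_const u x)
  have h1 := (((d u v).sub (d v u)).add ((c u).clm_comp (c v))).sub ((c v).clm_comp (c u))
  have h2 : HasFDerivAt (fun y => riem G y u v) _ x :=
    ((differentiableAt_riem hG hx).hasFDerivAt.clm_apply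
      (hasFDerivAt_const u x)).clm_apply (hasFDerivAt_const v x)
  have h3 : (fun y => riem G y u v) = fun y => fderiv ℝ (chr G) y u v - fderiv ℝ (chr G) y v u
    + chr G y u ∘L chr G y v - chr G y v ∘L chr G y u := funext fun y => riem_apply G y u v
  rw [h3] at h2
  have h4 := congrArg (fun L => L e) (h2.unique h1)
  ext w
  have h5 := congrArg (fun L => L w) h4
  simp at h5 ⊢
  rw [h5]
  abel

/-- The second Bianchi identity. -/
theorem nablaRiem_cyclic (hG : IsMetricOn G Ω) (hx : x ∈ Ω) (a b c : V) :
    nablaRiem G x a b c + nablaRiem G x b c a + nablaRiem G x c a b = 0 := by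
  have hs : ∀ u v, fderiv ℝ (fderiv ℝ (chr G)) x u v = fderiv ℝ (fderiv ℝ (chr G)) x v u := fun u v =>
    (((contDiffOn_chr hG).contDiffAt (hG.isOpen.mem_nhds hx)).isSymmSndFDerivAt
      minSmoothness_two_le_infty).eq u v
  simp only [nablaRiem, fderiv_riem hG hx]
  -- Torsion-freeness and skewness of R pair off the six terms of type R(∇_a b, c), and the symmetry
  -- of second derivatives removes ∂∂Γ. The rest cancels as in the Jacobi identity for commutators.
  rw [riem_antisymm x b (chr G x a c), riem_antisymm x c (chr G x b a),
    riem_antisymm x a (chr G x c b), chr_symm hG hx a c, chr_symm hG hx b a,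
    chr_symm hG hx c b, hs a c, hs b a, hs c b]
  ext w
  simp [riem_apply]
  abel

theorem nablaRiem_antisymm (hG : IsMetricOn G Ω) (hx : x ∈ Ω) (e u v : V) : nablaRiem G x e u v = - nablaRiem G x e v u := by
  have h1 : fderiv ℝ (riem G) x e u v = - fderiv ℝ (riem G) x e v u := by
    rw [fderiv_riem hG hx, fderiv_riem hG hx]
    abel
  simp only [nablaRiem]
  rw [h1, riem_antisymm x u v, riem_antisymm x (chr G x e u) v, riem_antisymm x u (chr G x e v)]
  ext w
  simp
  abel

/-- The endomorphisms `∇_e R(u,v)` are skew-adjoint. -/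
theorem inner_nablaRiem_antisymm (hG : IsMetricOn G Ω) (hx : x ∈ Ω) (e u v w z : V) :
    G x (nablaRiem G x e u v w) z = - G x (nablaRiem G x e u v z) w := by
  have hd := (differentiableAt_metric hG hx).hasFDerivAt
  have e1 : (fun y => G y (riem G y u v w) z) =ᶠ[𝓝 x] fun y => - G y (riem G y u v z) w := by
    filter_upwards [hG.isOpen.mem_nhds hx] with y hy using inner_riem_antisymm hG hy u v w z
  have e2 := (hd.clm_apply (hasFDerivAt_riem_apply hG hx u v w)).clm_apply (hasFDerivAt_const z x)
  have e3 := ((hd.clm_apply (hasFDerivAt_riem_apply hG hx u v z)).clm_apply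
    (hasFDerivAt_const w x)).neg
  have e4 := congrArg (fun L => L e) ((e2.congr_of_eventuallyEq e1.symm).unique e3)
  simp [fderiv_metric hG hx] at e4
  have i1 := inner_riem_antisymm hG hx (chr G x e u) v w z
  have i2 := inner_riem_antisymm hG hx u (chr G x e v) w z
  have i3 := inner_riem_antisymm hG hx u v (chr G x e w) z
  have i4 := inner_riem_antisymm hG hx u v w (chr G x e z)
  simp [nablaRiem]
  linarith

variable (G) in
/-- The covariant derivative of the Ricci tensor. -/
def nablaRicci (x e v w : V) : ℝ :=
  fderiv ℝ (fun y => ricci G y v w) x e - ricci G x (chr G x e v) w - ricci G x v (chr G x e w)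

/-- Contraction commutes with ∇: the two corrections in which Γ_e acts on the contracted pair of
indices differ by the trace of a commutator. -/
theorem sum_nablaRiem_left (hG : IsMetricOn G Ω) (hx : x ∈ Ω) (e v w : V) :
    ∑ i, coframe V i (nablaRiem G x e (frame V i) v w) = nablaRicci G x e v w := by
  have h1 : HasFDerivAt (fun y => ricci G y v w) (∑ i, (coframe V i) ∘L
      ((((fderiv ℝ (riem G) x).flip (frame V i)).flip v).flip w)) x := by
    have : (fun y => ricci G y v w) =ᶠ[𝓝 x]
        fun y => ∑ i, coframe V i (riem G y (frame V i) v w) := by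
      filter_upwards [hG.isOpen.mem_nhds hx] with y hy using ricci_eq_sum hG hy v w
    refine HasFDerivAt.congr_of_eventuallyEq ?_ this
    exact HasFDerivAt.fun_sum fun i _ =>
      (coframe V i).hasFDerivAt.comp x (hasFDerivAt_riem_apply hG hx (frame V i) v w)
  have h2 : ∑ i, coframe V i (chr G x e (riem G x (frame V i) v w)) =
      ∑ i, coframe V i (riem G x (chr G x e (frame V i)) v w) := by
    let A : V →ₗ[ℝ] V := (chr G x e : V →L[ℝ] V)
    let R : V →ₗ[ℝ] V := (((riem G x).flip v).flip w : V →L[ℝ] V)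
    have t1 := sum_coframe_apply (A * R)
    have t2 := sum_coframe_apply (R * A)
    rw [LinearMap.trace_mul_comm] at t1
    simpa [A, R] using t1.trans t2.symm
  rw [nablaRicci, h1.fderiv, ricci_eq_sum hG hx, ricci_eq_sum hG hx]
  simp [nablaRiem, Finset.sum_add_distrib, Finset.sum_sub_distrib, h2]
  ring

/-- The contracted second Bianchi identity. -/
theorem sum_nablaRiem (hG : IsMetricOn G Ω) (hx : x ∈ Ω) (u v w : V) :
    ∑ i, coframe V i (nablaRiem G x (frame V i) u v w) =
      nablaRicci G x u v w - nablaRicci G x v u w := by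
  rw [← sum_nablaRiem_left hG hx, ← sum_nablaRiem_left hG hx, ← Finset.sum_sub_distrib]
  refine Finset.sum_congr rfl fun i _ => ?_
  have h := congrArg (fun L => L w) (nablaRiem_cyclic hG hx (frame V i) u v)
  rw [nablaRiem_antisymm hG hx u v] at h
  simp at h
  rw [← map_sub]
  congr 1
  rw [← sub_eq_zero, ← h]
  abel

/-! ### Schur's lemma -/

section Einstein

variable {ρ : V → ℝ}

theorem exists_inner_ne_zero (hG : IsMetricOn G Ω) (hx : x ∈ Ω) (hV : 0 < Module.finrank ℝ V) :
    ∃ v w, G x v w ≠ 0 := by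
  have := Module.finrank_pos_iff.1 hV
  obtain ⟨v, hv⟩ := exists_ne (0 : V)
  by_contra! h
  exact hv (hG.nondegenerate x hx v (h v))

/-- No regularity of ρ is assumed; near x it is the quotient Ric(v, w) / G(v, w) for a pair with
G(v, w) ≠ 0. -/
theorem differentiableAt_einstein_factor (hG : IsMetricOn G Ω) (hx : x ∈ Ω)
    (hV : 0 < Module.finrank ℝ V)
    (hE : ∀ y ∈ Ω, ∀ v w, ricci G y v w = ρ y * G y v w) : DifferentiableAt ℝ ρ x := by
  obtain ⟨v, w, hvw⟩ := exists_inner_ne_zero hG hx hV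
  have hg := (hasFDerivAt_metric_apply hG hx v w).differentiableAt
  have hr : DifferentiableAt ℝ (fun y => ricci G y v w) x :=
    ((contDiffOn_ricci hG v w).differentiableOn (by simp)).differentiableAt
      (hG.isOpen.mem_nhds hx)
  refine (hr.fun_mul (hg.fun_inv hvw)).congr_of_eventuallyEq ?_
  filter_upwards [hG.isOpen.mem_nhds hx, hg.continuousAt.eventually_ne hvw] with y hy hy'
  rw [hE y hy, mul_assoc, mul_inv_cancel₀ hy', mul_one]

/-- The metric is parallel, so only the derivative of ρ survives. -/
theorem nablaRicci_of_einstein (hG : IsMetricOn G Ω) (hx : x ∈ Ω)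
    (hV : 0 < Module.finrank ℝ V)
    (hE : ∀ y ∈ Ω, ∀ v w, ricci G y v w = ρ y * G y v w) (e v w : V) :
    nablaRicci G x e v w = fderiv ℝ ρ x e * G x v w := by
  have h : (fun y => ricci G y v w) =ᶠ[𝓝 x] fun y => ρ y * G y v w := by
    filter_upwards [hG.isOpen.mem_nhds hx] with y hy using hE y hy v w
  rw [nablaRicci, h.fderiv_eq, hE x hx, hE x hx,
    ((differentiableAt_einstein_factor hG hx hV hE).hasFDerivAt.fun_mul
      (hasFDerivAt_metric_apply hG hx v w)).fderiv]
  simp [fderiv_metric hG hx]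
  ring

theorem sum_apply_sharp_coframe (hG : IsMetricOn G Ω) (hx : x ∈ Ω) (α : V →L[ℝ] ℝ) (v : V) :
    ∑ i, α (frame V i) * G x v (sharp G x (coframe V i)) = α v := by
  simp only [flat_sharp_apply' hG hx]
  conv_rhs => rw [← sum_coframe_smul v]
  simp [mul_comm]

/-- **Schur's lemma**, infinitesimal version. -/
theorem fderiv_einstein_factor (hG : IsMetricOn G Ω) (hx : x ∈ Ω)
    (hV : 3 ≤ Module.finrank ℝ V)
    (hE : ∀ y ∈ Ω, ∀ v w, ricci G y v w = ρ y * G y v w) : fderiv ℝ ρ x = 0 := by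
  have hV0 : 0 < Module.finrank ℝ V := by omega
  have hn := nablaRicci_of_einstein hG hx hV0 hE
  ext b
  -- The double contraction of ∇R is evaluated in two ways. Summing over i first, the contracted
  -- Bianchi identity gives m dρ(b) − dρ(b), with m the dimension.
  have e1 : ∑ k, ∑ i, coframe V i (nablaRiem G x (frame V i) b (frame V k)
      (sharp G x (coframe V k))) = (Module.finrank ℝ V - 1) * fderiv ℝ ρ x b := by
    simp only [sum_nablaRiem hG hx, hn, Finset.sum_sub_distrib, sum_apply_sharp_coframe hG hx,
      ← Finset.mul_sum]
    simp [flat_sharp_apply' hG hx, coframe_frame]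
    ring
  -- Summing over k first, skewness in each of the two pairs of indices turns the expression into
  -- the divergence of Ric = ρ G, which is dρ(b). Comparison gives (m − 2) dρ = 0.
  have e2 : ∑ k, ∑ i, coframe V i (nablaRiem G x (frame V i) b (frame V k)
      (sharp G x (coframe V k))) = fderiv ℝ ρ x b := by
    rw [Finset.sum_comm, ← sum_apply_sharp_coframe hG hx (fderiv ℝ ρ x) b]
    refine Finset.sum_congr rfl fun i _ => ?_
    rw [← hn, ← sum_nablaRiem_left hG hx]
    refine Finset.sum_congr rfl fun k _ => ?_
    rw [← flat_sharp_apply' hG hx, inner_nablaRiem_antisymm hG hx,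
      flat_sharp_apply' hG hx, nablaRiem_antisymm hG hx]
    simp
  have h3 : (3 : ℝ) ≤ Module.finrank ℝ V := by exact_mod_cast hV
  have h4 : ((Module.finrank ℝ V : ℝ) - 2) * fderiv ℝ ρ x b = 0 := by linarith
  rcases mul_eq_zero.1 h4 with h | h
  · linarith
  · simpa using h

/-- **Schur's lemma**: the Einstein factor is locally constant. -/
theorem einstein_factor_eventually_eq (hG : IsMetricOn G Ω) (hx : x ∈ Ω)
    (hV : 3 ≤ Module.finrank ℝ V)
    (hE : ∀ y ∈ Ω, ∀ v w, ricci G y v w = ρ y * G y v w) : ∀ᶠ y in 𝓝 x, ρ y = ρ x := by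
  obtain ⟨r, hr, hball⟩ := Metric.isOpen_iff.1 hG.isOpen x hx
  filter_upwards [Metric.ball_mem_nhds x hr] with y hy
  refine Metric.isOpen_ball.is_const_of_fderiv_eq_zero (𝕜 := ℝ)
    (convex_ball x r).isPreconnected ?_ ?_ hy (Metric.mem_ball_self hr)
  · exact fun z hz => (differentiableAt_einstein_factor hG (hball hz) (by omega)
      hE).differentiableWithinAt
  · exact fun z hz => fderiv_einstein_factor hG (hball hz) hV hE

/-- The curvature tensor of an Einstein metric is divergence-free. -/
theorem sum_nablaRiem_of_einstein (hG : IsMetricOn G Ω) (hx : x ∈ Ω)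
    (hV : 3 ≤ Module.finrank ℝ V)
    (hE : ∀ y ∈ Ω, ∀ v w, ricci G y v w = ρ y * G y v w) (u v w : V) :
    ∑ i, coframe V i (nablaRiem G x (frame V i) u v w) = 0 := by
  rw [sum_nablaRiem hG hx, nablaRicci_of_einstein hG hx (by omega) hE,
    nablaRicci_of_einstein hG hx (by omega) hE, fderiv_einstein_factor hG hx hV hE]
  simp

end Einstein

end CoordGeom

/-! ### Naturality of the connection and the curvature under pull-back -/

namespace CoordGeom

variable {V : Type*} [NormedAddCommGroup V] [NormedSpace ℝ V] [FiniteDimensional ℝ V]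

section pullback

/-- `G'` is the pull-back of `G` by `ψ` on `Ω'`. -/
structure IsPullbackOn (G G' : V → V →L[ℝ] V →L[ℝ] ℝ) (Ω Ω' : Set V) (ψ : V → V) : Prop where
  target : IsMetricOn G Ω
  source : IsMetricOn G' Ω'
  smooth : ContDiffOn ℝ ∞ ψ Ω'
  mapsTo : Set.MapsTo ψ Ω' Ω
  eq : ∀ y ∈ Ω', ∀ v w, G' y v w = G (ψ y) (fderiv ℝ ψ y v) (fderiv ℝ ψ y w)

variable {G G' : V → V →L[ℝ] V →L[ℝ] ℝ} {Ω Ω' : Set V} {ψ : V → V} {y : V}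

/-- The kernel of dψ lies in the radical of G', which is zero; invertibility of ψ need not be
assumed. -/
theorem IsPullbackOn.exists_equiv (h : IsPullbackOn G G' Ω Ω' ψ) (hy : y ∈ Ω') :
    ∃ e : V ≃ₗ[ℝ] V, ∀ v, e v = fderiv ℝ ψ y v := by
  have hinj : Function.Injective (fderiv ℝ ψ y : V →ₗ[ℝ] V) := by
    rw [injective_iff_map_eq_zero]
    intro v hv
    have hv' : fderiv ℝ ψ y v = 0 := hv
    refine h.source.nondegenerate y hy v fun w => ?_
    rw [h.eq y hy, hv']
    simp
  exact ⟨LinearEquiv.ofInjectiveEndo _ hinj, fun v => rfl⟩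

theorem IsPullbackOn.hasFDerivAt (h : IsPullbackOn G G' Ω Ω' ψ) (hy : y ∈ Ω') :
    HasFDerivAt ψ (fderiv ℝ ψ y) y :=
  ((h.smooth.differentiableOn (by simp)).differentiableAt
    (h.source.isOpen.mem_nhds hy)).hasFDerivAt

theorem IsPullbackOn.hasFDerivAt_fderiv_apply (h : IsPullbackOn G G' Ω Ω' ψ) (hy : y ∈ Ω')
    (v : V) : HasFDerivAt (fun z => fderiv ℝ ψ z v) ((fderiv ℝ (fderiv ℝ ψ) y).flip v) y := by
  have h1 : HasFDerivAt (fderiv ℝ ψ) (fderiv ℝ (fderiv ℝ ψ) y) y :=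
    (((contDiffOn_fderiv_of h.source.isOpen h.smooth).differentiableOn
      (by simp)).differentiableAt (h.source.isOpen.mem_nhds hy)).hasFDerivAt
  refine (h1.clm_apply (hasFDerivAt_const v y)).congr_fderiv ?_
  ext; simp

theorem IsPullbackOn.fderiv_fderiv_symm (h : IsPullbackOn G G' Ω Ω' ψ) (hy : y ∈ Ω') (u v : V) :
    fderiv ℝ (fderiv ℝ ψ) y u v = fderiv ℝ (fderiv ℝ ψ) y v u :=
  ((h.smooth.contDiffAt (h.source.isOpen.mem_nhds hy)).isSymmSndFDerivAt
    minSmoothness_two_le_infty).eq u v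

/-- Transformation law of the Christoffel symbols. -/
theorem IsPullbackOn.fderiv_chr (h : IsPullbackOn G G' Ω Ω' ψ) (hy : y ∈ Ω') (u v : V) :
    fderiv ℝ ψ y (chr G' y u v) =
      fderiv ℝ (fderiv ℝ ψ) y u v + chr G (ψ y) (fderiv ℝ ψ y u) (fderiv ℝ ψ y v) := by
  obtain ⟨e, he⟩ := h.exists_equiv hy
  have hψ := h.mapsTo hy
  -- The connection pulled back through dψ is symmetric, because D²ψ is, and metric for G';
  -- uniqueness identifies it.
  rw [chr_apply, christoffel_unique h.source hy (fun u v => e.symm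
    (fderiv ℝ (fderiv ℝ ψ) y u v + chr G (ψ y) (fderiv ℝ ψ y u) (fderiv ℝ ψ y v))),
    ← he, LinearEquiv.apply_symm_apply]
  · intro u v
    rw [h.fderiv_fderiv_symm hy, chr_symm h.target hψ]
  · intro u v w
    rw [h.eq y hy, h.eq y hy, ← he (e.symm _), ← he (e.symm _), LinearEquiv.apply_symm_apply,
      LinearEquiv.apply_symm_apply]
    have e1 : (fun z => G' z v w) =ᶠ[𝓝 y] fun z => G (ψ z) (fderiv ℝ ψ z v) (fderiv ℝ ψ z w) := by
      filter_upwards [h.source.isOpen.mem_nhds hy] with z hz using h.eq z hz v w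
    have e2 := ((((differentiableAt_metric h.target hψ).hasFDerivAt.comp y
      (h.hasFDerivAt hy)).clm_apply (h.hasFDerivAt_fderiv_apply hy v)).clm_apply
      (h.hasFDerivAt_fderiv_apply hy w))
    have e3 := congrArg (fun L => L u) (((hasFDerivAt_metric_apply h.source hy v
      w).congr_of_eventuallyEq e1.symm).unique e2)
    simp [fderiv_metric h.target hψ] at e3
    rw [e3]
    simp
    ring

/-- Naturality of the curvature tensor. -/
theorem IsPullbackOn.fderiv_riem (h : IsPullbackOn G G' Ω Ω' ψ) (hy : y ∈ Ω') (u v w : V) :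
    fderiv ℝ ψ y (riem G' y u v w) =
      riem G (ψ y) (fderiv ℝ ψ y u) (fderiv ℝ ψ y v) (fderiv ℝ ψ y w) := by
  have hψ := h.mapsTo hy
  have hP : HasFDerivAt (fderiv ℝ ψ) (fderiv ℝ (fderiv ℝ ψ) y) y :=
    (((contDiffOn_fderiv_of h.source.isOpen h.smooth).differentiableOn
      (by simp)).differentiableAt (h.source.isOpen.mem_nhds hy)).hasFDerivAt
  have hPP : HasFDerivAt (fderiv ℝ (fderiv ℝ ψ)) (fderiv ℝ (fderiv ℝ (fderiv ℝ ψ)) y) y :=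
    (((contDiffOn_fderiv_of h.source.isOpen (contDiffOn_fderiv_of h.source.isOpen
      h.smooth)).differentiableOn (by simp)).differentiableAt
      (h.source.isOpen.mem_nhds hy)).hasFDerivAt
  -- The derivative of the transformation law of the Christoffel symbols. After antisymmetrization
  -- in u, v the third derivatives of ψ drop out, and the second derivatives cancel against those
  -- coming from the terms quadratic in Γ.
  have key : ∀ u v : V, fderiv ℝ ψ y (fderiv ℝ (chr G') y u v w) =
      fderiv ℝ (fderiv ℝ (fderiv ℝ ψ)) y u v w
      + fderiv ℝ (chr G) (ψ y) (fderiv ℝ ψ y u) (fderiv ℝ ψ y v) (fderiv ℝ ψ y w)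
      + chr G (ψ y) (fderiv ℝ (fderiv ℝ ψ) y u v) (fderiv ℝ ψ y w)
      + chr G (ψ y) (fderiv ℝ ψ y v) (fderiv ℝ (fderiv ℝ ψ) y u w)
      - fderiv ℝ (fderiv ℝ ψ) y u (chr G' y v w) := by
    intro u v
    have e1 : (fun z => fderiv ℝ ψ z (chr G' z v w)) =ᶠ[𝓝 y] fun z =>
        fderiv ℝ (fderiv ℝ ψ) z v w + chr G (ψ z) (fderiv ℝ ψ z v) (fderiv ℝ ψ z w) := by
      filter_upwards [h.source.isOpen.mem_nhds hy] with z hz using h.fderiv_chr hz v w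
    have e2 := hP.clm_apply (hasFDerivAt_chr_apply h.source hy v w)
    have e3 := ((hPP.clm_apply (hasFDerivAt_const v y)).clm_apply (hasFDerivAt_const w y)).add
      (((((differentiableAt_chr h.target hψ).hasFDerivAt.comp y
      (h.hasFDerivAt hy)).clm_apply (h.hasFDerivAt_fderiv_apply hy v)).clm_apply
      (h.hasFDerivAt_fderiv_apply hy w)))
    have e4 := congrArg (fun L => L u) ((e2.congr_of_eventuallyEq e1.symm).unique e3)
    simp at e4
    rw [eq_sub_iff_add_eq, e4]
    abel
  have hs : fderiv ℝ (fderiv ℝ (fderiv ℝ ψ)) y u v = fderiv ℝ (fderiv ℝ (fderiv ℝ ψ)) y v u :=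
    (((contDiffOn_fderiv_of h.source.isOpen h.smooth).contDiffAt
      (h.source.isOpen.mem_nhds hy)).isSymmSndFDerivAt minSmoothness_two_le_infty).eq u v
  rw [riem_apply, riem_apply]
  simp only [add_apply, sub_apply, ContinuousLinearMap.comp_apply, map_add, map_sub, key,
    h.fderiv_chr hy]
  rw [hs, h.fderiv_fderiv_symm hy u v]
  abel

/-- Naturality of the Ricci tensor. -/
theorem IsPullbackOn.ricci_eq (h : IsPullbackOn G G' Ω Ω' ψ) (hy : y ∈ Ω') (v w : V) :
    ricci G' y v w = ricci G (ψ y) (fderiv ℝ ψ y v) (fderiv ℝ ψ y w) := by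
  obtain ⟨e, he⟩ := h.exists_equiv hy
  rw [ricci_eq_trace h.source hy, ricci_eq_trace h.target (h.mapsTo hy),
    ← LinearMap.trace_conj' _ e]
  congr 1
  ext u
  obtain ⟨u, rfl⟩ := e.surjective u
  have hu : e.symm (fderiv ℝ ψ y u) = u := by rw [← he, LinearEquiv.symm_apply_apply]
  simp [LinearEquiv.conj_apply, he, h.fderiv_riem hy, hu]

end pullback

end CoordGeom

/-! ### Connection and curvature of a warped product in coordinates -/

namespace CoordGeom

variable {E : Type*} [NormedAddCommGroup E] [NormedSpace ℝ E] [FiniteDimensional ℝ E]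

/-- `G` is the warped product metric `ε dt² + f(t)² h` on `J × Ω`. -/
structure IsWarpedOn (G : ℝ × E → ℝ × E →L[ℝ] ℝ × E →L[ℝ] ℝ) (ε : ℝ) (f : ℝ → ℝ)
    (h : E → E →L[ℝ] E →L[ℝ] ℝ) (J : Set ℝ) (Ω : Set E) : Prop where
  isOpen : IsOpen J
  smooth : ContDiffOn ℝ ∞ f J
  pos : ∀ t ∈ J, 0 < f t
  sign : ε = 1 ∨ ε = -1
  fiber : IsMetricOn h Ω
  eq : ∀ t ∈ J, ∀ x ∈ Ω, ∀ p q : ℝ × E,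
    G (t, x) p q = ε * (p.1 * q.1) + f t ^ 2 * h x p.2 q.2

namespace IsWarpedOn

variable {G : ℝ × E → ℝ × E →L[ℝ] ℝ × E →L[ℝ] ℝ} {ε : ℝ} {f : ℝ → ℝ}
  {h : E → E →L[ℝ] E →L[ℝ] ℝ} {J : Set ℝ} {Ω : Set E} {t : ℝ} {x : E}

theorem ne_zero (hW : IsWarpedOn G ε f h J Ω) (ht : t ∈ J) : f t ≠ 0 := (hW.pos t ht).ne'

theorem sq_sign (hW : IsWarpedOn G ε f h J Ω) : ε * ε = 1 := by
  rcases hW.sign with h | h <;> simp [h]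

theorem isMetricOn (hW : IsWarpedOn G ε f h J Ω) : IsMetricOn G (J ×ˢ Ω) where
  isOpen := hW.isOpen.prod hW.fiber.isOpen
  smooth := by
    rw [contDiffOn_clm_apply]
    intro p
    rw [contDiffOn_clm_apply]
    intro q
    have hf : ContDiffOn ℝ ∞ (fun y : ℝ × E => f y.1) (J ×ˢ Ω) :=
      hW.smooth.comp contDiffOn_fst fun y hy => hy.1
    have hh : ContDiffOn ℝ ∞ (fun y : ℝ × E => h y.2) (J ×ˢ Ω) :=
      hW.fiber.smooth.comp contDiffOn_snd fun y hy => hy.2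
    refine ContDiffOn.congr
      (f := fun y : ℝ × E => ε * (p.1 * q.1) + f y.1 ^ 2 * h y.2 p.2 q.2) ?_
      fun y hy => hW.eq y.1 hy.1 y.2 hy.2 p q
    exact contDiffOn_const.add ((hf.pow 2).mul
      ((hh.clm_apply contDiffOn_const).clm_apply contDiffOn_const))
  symm := fun y hy v w => by
    rw [← Prod.mk.eta (p := y), hW.eq y.1 hy.1 y.2 hy.2, hW.eq y.1 hy.1 y.2 hy.2,
      hW.fiber.symm y.2 hy.2, mul_comm v.1]
  nondegenerate := fun y hy v hv => by
    have hε : ε ≠ 0 := by rcases hW.sign with h | h <;> simp [h]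
    have h0 : ∀ w : ℝ × E, ε * (v.1 * w.1) + f y.1 ^ 2 * h y.2 v.2 w.2 = 0 := fun w => by
      rw [← hW.eq y.1 hy.1 y.2 hy.2, Prod.mk.eta]; exact hv w
    refine Prod.ext ?_ (hW.fiber.nondegenerate y.2 hy.2 _ fun w => ?_)
    · have := h0 (1, 0)
      simpa [hε] using this
    · have := h0 (0, w)
      simpa [hW.ne_zero hy.1] using this

theorem hasDerivAt (hW : IsWarpedOn G ε f h J Ω) (ht : t ∈ J) : HasDerivAt f (deriv f t) t :=
  ((hW.smooth.differentiableOn (by simp)).differentiableAt (hW.isOpen.mem_nhds ht)).hasDerivAt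

theorem smooth_deriv (hW : IsWarpedOn G ε f h J Ω) : ContDiffOn ℝ ∞ (deriv f) J :=
  hW.smooth.deriv_of_isOpen hW.isOpen (by simp)

theorem hasDerivAt_deriv (hW : IsWarpedOn G ε f h J Ω) (ht : t ∈ J) :
    HasDerivAt (deriv f) (deriv (deriv f) t) t :=
  ((hW.smooth_deriv.differentiableOn (by simp)).differentiableAt
    (hW.isOpen.mem_nhds ht)).hasDerivAt

theorem _root_.HasDerivAt.comp_fst {k : ℝ → ℝ} {k' : ℝ} (hk : HasDerivAt k k' t) :
    HasFDerivAt (fun y : ℝ × E => k y.1) (k' • ContinuousLinearMap.fst ℝ ℝ E) (t, x) :=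
  HasDerivAt.comp_hasFDerivAt (t, x) (h₂ := k) hk hasFDerivAt_fst

theorem _root_.HasFDerivAt.comp_snd {W : Type*} [NormedAddCommGroup W] [NormedSpace ℝ W]
    {k : E → W} {k' : E →L[ℝ] W} (hk : HasFDerivAt k k' x) :
    HasFDerivAt (fun y : ℝ × E => k y.2) (k' ∘L ContinuousLinearMap.snd ℝ ℝ E) (t, x) :=
  HasFDerivAt.comp (t, x) (g := k) hk hasFDerivAt_snd

theorem mem (ht : t ∈ J) (hx : x ∈ Ω) : (t, x) ∈ J ×ˢ Ω := ⟨ht, hx⟩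

theorem fderiv_eq (hW : IsWarpedOn G ε f h J Ω) (ht : t ∈ J) (hx : x ∈ Ω) (u v w : ℝ × E) :
    fderiv ℝ G (t, x) u v w = 2 * f t * deriv f t * u.1 * h x v.2 w.2
      + f t ^ 2 * fderiv ℝ h x u.2 v.2 w.2 := by
  have e1 : (fun y => G y v w) =ᶠ[𝓝 (t, x)]
      fun y => ε * (v.1 * w.1) + f y.1 * f y.1 * h y.2 v.2 w.2 := by
    filter_upwards [hW.isMetricOn.isOpen.mem_nhds (mem ht hx)] with y hy
    rw [← Prod.mk.eta (p := y), hW.eq y.1 hy.1 y.2 hy.2]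
    ring
  have hf := (hW.hasDerivAt ht).comp_fst (x := x)
  have e2 := ((hf.mul hf).mul
    ((hasFDerivAt_metric_apply hW.fiber hx v.2 w.2).comp_snd (t := t))).const_add (ε * (v.1 * w.1))
  have e3 := congrArg (fun L => L u) (((hasFDerivAt_metric_apply hW.isMetricOn (mem ht hx) v
    w).congr_of_eventuallyEq e1.symm).unique e2)
  simp at e3
  rw [e3]
  ring

/-- The right-hand side is symmetric and metric, so uniqueness of the Levi-Civita connection applies
and the inverse metric is not needed. -/
theorem chr_eq (hW : IsWarpedOn G ε f h J Ω) (ht : t ∈ J) (hx : x ∈ Ω) (u v : ℝ × E) :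
    chr G (t, x) u v = (-(ε * (f t * deriv f t)) * h x u.2 v.2,
      chr h x u.2 v.2 + (deriv f t / f t) • (u.1 • v.2 + v.1 • u.2)) := by
  have hf := hW.ne_zero ht
  rw [chr_apply]
  refine christoffel_unique hW.isMetricOn (mem ht hx) (fun u v => (-(ε * (f t * deriv f t)) * h x u.2 v.2,
      chr h x u.2 v.2 + (deriv f t / f t) • (u.1 • v.2 + v.1 • u.2))) ?_ ?_ u v
  · intro u v
    rw [chr_symm hW.fiber hx, hW.fiber.symm x hx u.2, add_comm (u.1 • v.2)]
  · intro u v w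
    rw [hW.fderiv_eq ht hx, hW.eq t ht x hx, hW.eq t ht x hx, fderiv_metric hW.fiber hx,
      hW.fiber.symm x hx u.2 v.2]
    simp only [map_add, map_smul, add_apply, smul_apply, smul_eq_mul]
    rcases hW.sign with rfl | rfl <;> field_simp <;> ring

theorem fderiv_chr_eq (hW : IsWarpedOn G ε f h J Ω) (ht : t ∈ J) (hx : x ∈ Ω) (u v w : ℝ × E) :
    fderiv ℝ (chr G) (t, x) u v w =
      (-(ε * ((deriv f t ^ 2 + f t * deriv (deriv f) t) * u.1 * h x v.2 w.2
          + f t * deriv f t * fderiv ℝ h x u.2 v.2 w.2)),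
      fderiv ℝ (chr h) x u.2 v.2 w.2
        + ((deriv (deriv f) t / f t - (deriv f t / f t) ^ 2) * u.1) •
          (v.1 • w.2 + w.1 • v.2)) := by
  have hf := hW.ne_zero ht
  have e1 : (fun y => chr G y v w) =ᶠ[𝓝 (t, x)]
      fun y => (-(ε * (f y.1 * deriv f y.1)) * h y.2 v.2 w.2,
      chr h y.2 v.2 w.2 + (deriv f y.1 / f y.1) • (v.1 • w.2 + w.1 • v.2)) := by
    filter_upwards [hW.isMetricOn.isOpen.mem_nhds (mem ht hx)] with y hy
    rw [← Prod.mk.eta (p := y), hW.chr_eq hy.1 hy.2]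
  have d1 := (((hW.hasDerivAt ht).mul (hW.hasDerivAt_deriv ht)).const_mul ε).neg.comp_fst (x := x)
  have d2 := ((hW.hasDerivAt_deriv ht).div (hW.hasDerivAt ht) hf).comp_fst (x := x)
  have e2 := (d1.mul ((hasFDerivAt_metric_apply hW.fiber hx v.2 w.2).comp_snd (t := t))).prodMk
    (((hasFDerivAt_chr_apply hW.fiber hx v.2 w.2).comp_snd (t := t)).add
      (d2.smul_const (v.1 • w.2 + w.1 • v.2)))
  have e3 := congrArg (fun L => L u) (((hasFDerivAt_chr_apply hW.isMetricOn (mem ht hx) v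
    w).congr_of_eventuallyEq e1.symm).unique e2)
  simp only [ContinuousLinearMap.flip_apply] at e3
  rw [e3]
  refine Prod.ext ?_ ?_
  · simp
    ring
  · have e : (deriv (deriv f) t * f t - deriv f t * deriv f t) / f t ^ 2 =
        deriv (deriv f) t / f t - (deriv f t / f t) ^ 2 := by field_simp
    simp [e]

theorem riem_eq (hW : IsWarpedOn G ε f h J Ω) (ht : t ∈ J) (hx : x ∈ Ω) (u v w : ℝ × E) :
    riem G (t, x) u v w =
      (-(ε * f t * deriv (deriv f) t) * (u.1 * h x v.2 w.2 - v.1 * h x u.2 w.2),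
      riem h x u.2 v.2 w.2
        - (ε * deriv f t ^ 2) • (h x v.2 w.2 • u.2 - h x u.2 w.2 • v.2)
        + (deriv (deriv f) t / f t * w.1) • (u.1 • v.2 - v.1 • u.2)) := by
  have hf := hW.ne_zero ht
  -- With f' = k f both f' and f'/f are expressed through k, and the identities close without
  -- clearing denominators.
  obtain ⟨k, hk⟩ : ∃ k, k = deriv f t / f t := ⟨_, rfl⟩
  have hk' : deriv f t = k * f t := by rw [hk]; field_simp
  rw [riem_apply, riem_apply]
  simp only [add_apply, sub_apply, ContinuousLinearMap.comp_apply, hW.chr_eq ht hx,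
    hW.fderiv_chr_eq ht hx, ← hk]
  rw [hk']
  refine Prod.ext ?_ ?_
  · simp only [Prod.fst_add, Prod.fst_sub, map_add, map_smul, fderiv_metric hW.fiber hx,
      smul_eq_mul]
    rw [hW.fiber.symm x hx v.2 (chr h x u.2 w.2), hW.fiber.symm x hx u.2 (chr h x v.2 w.2),
      chr_symm hW.fiber hx v.2 u.2, hW.fiber.symm x hx v.2 u.2]
    rw [hW.fiber.symm x hx (chr h x u.2 w.2), hW.fiber.symm x hx (chr h x v.2 w.2)]
    ring
  · simp only [Prod.snd_add, Prod.snd_sub, map_add, map_smul, smul_eq_mul]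
    rw [chr_symm hW.fiber hx v.2 u.2]
    module

end IsWarpedOn

end CoordGeom

/-! ### Ricci, scalar and Weyl curvature of a warped product -/

namespace CoordGeom

variable {E : Type*} [NormedAddCommGroup E] [NormedSpace ℝ E] [FiniteDimensional ℝ E]

/-- The basis of `ℝ × E` made of `(1, 0)` and the `(0, frame E i)`. -/
def prodFrame (E : Type*) [NormedAddCommGroup E] [NormedSpace ℝ E] [FiniteDimensional ℝ E] :
    Module.Basis (Unit ⊕ Fin (Module.finrank ℝ E)) ℝ (ℝ × E) :=
  (Module.Basis.singleton Unit ℝ).prod (frame E)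

theorem trace_prod (T : ℝ × E →ₗ[ℝ] ℝ × E) : LinearMap.trace ℝ (ℝ × E) T =
    (T (1, 0)).1 + ∑ i, coframe E i (T (0, frame E i)).2 := by
  classical
  rw [← sum_coord_apply (prodFrame E)]
  simp [prodFrame, coframe]

section inner

variable {V : Type*} [NormedAddCommGroup V] [NormedSpace ℝ V] [FiniteDimensional ℝ V]
  {G : V → V →L[ℝ] V →L[ℝ] ℝ} {Ω : Set V} {x : V}

theorem inner_ricciOp (hG : IsMetricOn G Ω) (hx : x ∈ Ω) (v w : V) :
    G x (ricciOp G x v) w = ricci G x v w := by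
  rw [ricciOp, map_sum]
  conv_rhs => rw [← sum_coframe_smul w, (isBilin_ricci hG hx).sum_right Finset.univ]
  simp [flat_sharp_apply hG hx, mul_comm]

theorem metricTrace_add (B C : V → V → ℝ) :
    metricTrace G x (fun v w => B v w + C v w) = metricTrace G x B + metricTrace G x C := by
  simp [metricTrace, Finset.sum_add_distrib]

theorem metricTrace_sub (B C : V → V → ℝ) :
    metricTrace G x (fun v w => B v w - C v w) = metricTrace G x B - metricTrace G x C := by
  simp [metricTrace, Finset.sum_sub_distrib]

theorem metricTrace_const_mul (c : ℝ) (B : V → V → ℝ) :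
    metricTrace G x (fun v w => c * B v w) = c * metricTrace G x B := by
  simp [metricTrace, Finset.mul_sum]

theorem metricTrace_zero : metricTrace G x (fun _ _ => 0) = 0 := by
  simp [metricTrace]

theorem metricTrace_metric (hG : IsMetricOn G Ω) (hx : x ∈ Ω) :
    metricTrace G x (fun v w => G x v w) = Module.finrank ℝ V := by
  rw [← LinearMap.trace_id, ← metricTrace_inner hG hx]
  simp

/-- Contraction of `α ⊗ G(·, w)`. -/
theorem metricTrace_mul_inner_left (hG : IsMetricOn G Ω) (hx : x ∈ Ω) {B : V → V → ℝ}
    (hB : IsBilin B) (w z : V) : metricTrace G x (fun a b => B w b * G x a z) = B w z := by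
  rw [metricTrace]
  have h : ∀ i, B w (sharp G x (coframe V i)) * G x (frame V i) z =
      G x (frame V i) z * B w (sharp G x (coframe V i)) := fun i => mul_comm _ _
  simp only [h]
  rw [← hB.sum_right Finset.univ]
  congr 1
  refine eq_of_forall_inner hG hx fun u => ?_
  simp only [map_sum, map_smul, sum_apply, smul_apply,
    flat_sharp_apply hG hx, smul_eq_mul, hG.symm x hx _ z]
  conv_rhs => rw [← sum_coframe_smul u]
  simp [mul_comm]

theorem metricTrace_mul_inner_right (hG : IsMetricOn G Ω) (hx : x ∈ Ω) {B : V → V → ℝ}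
    (hB : IsBilin B) (w z : V) : metricTrace G x (fun a b => B a w * G x z b) = B z w := by
  simp only [metricTrace, flat_sharp_apply' hG hx]
  have h : ∀ i, B (frame V i) w * coframe V i z = coframe V i z * B (frame V i) w :=
    fun i => mul_comm _ _
  simp only [h]
  rw [← hB.sum_left Finset.univ, sum_coframe_smul]

theorem ricci_eq_metricTrace (hG : IsMetricOn G Ω) (hx : x ∈ Ω) (v w : V) :
    ricci G x v w = metricTrace G x fun a b => G x (riem G x a v w) b := by
  simp only [ricci_eq_sum hG hx, metricTrace, flat_sharp_apply' hG hx]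

end inner

namespace IsWarpedOn

variable {G : ℝ × E → ℝ × E →L[ℝ] ℝ × E →L[ℝ] ℝ} {ε : ℝ} {f : ℝ → ℝ}
  {h : E → E →L[ℝ] E →L[ℝ] ℝ} {J : Set ℝ} {Ω : Set E} {t : ℝ} {x : E}

theorem ricci_eq (hW : IsWarpedOn G ε f h J Ω) (ht : t ∈ J) (hx : x ∈ Ω) (v w : ℝ × E) :
    ricci G (t, x) v w =
      -(Module.finrank ℝ E * (deriv (deriv f) t / f t)) * (v.1 * w.1) + ricci h x v.2 w.2
      - ε * (f t * deriv (deriv f) t + (Module.finrank ℝ E - 1) * deriv f t ^ 2) * h x v.2 w.2 := by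
  rw [ricci_eq_trace hW.isMetricOn (mem ht hx), trace_prod]
  simp only [ContinuousLinearMap.coe_coe, ContinuousLinearMap.flip_apply, hW.riem_eq ht hx,
    map_add, map_sub, map_smul, smul_eq_mul, map_zero, zero_apply, Finset.sum_add_distrib,
    Finset.sum_sub_distrib, ← Finset.mul_sum, ← ricci_eq_sum hW.fiber hx, coframe_frame]
  have e : ∑ i, h x (frame E i) w.2 * coframe E i v.2 = h x v.2 w.2 := by
    conv_rhs => rw [← sum_coframe_smul v.2]
    simp [mul_comm]
  simp [e]
  ring

theorem sharp_eq (hW : IsWarpedOn G ε f h J Ω) (ht : t ∈ J) (hx : x ∈ Ω)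
    (α : ℝ × E →L[ℝ] ℝ) : sharp G (t, x) α = (ε * α (1, 0),
      (f t ^ 2)⁻¹ • sharp h x (α ∘L ContinuousLinearMap.inr ℝ ℝ E)) := by
  have hf := hW.ne_zero ht
  refine eq_of_forall_inner hW.isMetricOn (mem ht hx) fun z => ?_
  rw [flat_sharp_apply hW.isMetricOn (mem ht hx), hW.eq t ht x hx]
  simp only [map_smul, smul_apply, flat_sharp_apply hW.fiber hx, smul_eq_mul]
  have hz : z = z.1 • ((1 : ℝ), (0 : E)) + (0, z.2) := by ext <;> simp
  conv_lhs => rw [hz, map_add, map_smul]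
  field_simp
  simp
  linear_combination (- z.1 * α (1, 0)) * hW.sq_sign

/-- The trace is computed in `prodFrame`, whose first vector is orthogonal to the others, so no
mixed terms occur; ε is its own inverse. -/
theorem metricTrace_eq (hW : IsWarpedOn G ε f h J Ω) (ht : t ∈ J) (hx : x ∈ Ω)
    {B : ℝ × E → ℝ × E → ℝ} (hB : IsBilin B) : metricTrace G (t, x) B =
      ε * B (1, 0) (1, 0) + (f t ^ 2)⁻¹ * metricTrace h x fun v w => B (0, v) (0, w) := by
  rw [metricTrace_eq_sum G (t, x) hB (prodFrame E), Fintype.sum_sum_type]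
  congr 1
  · have : sharp G (t, x) (LinearMap.toContinuousLinearMap ((prodFrame E).coord (Sum.inl ()))) =
        ε • (1, 0) := by
      rw [hW.sharp_eq ht hx]
      have h0 : LinearMap.toContinuousLinearMap ((prodFrame E).coord (Sum.inl ())) ∘L
          ContinuousLinearMap.inr ℝ ℝ E = 0 := by
        ext v; simp [prodFrame]
      rw [h0]
      simp [prodFrame]
    rw [Fintype.sum_unique]
    change B (prodFrame E (Sum.inl ())) (sharp G (t, x)
      (LinearMap.toContinuousLinearMap ((prodFrame E).coord (Sum.inl ())))) = _
    rw [this, hB.smul_right]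
    simp [prodFrame]
  · rw [metricTrace, Finset.mul_sum]
    refine Finset.sum_congr rfl fun i _ => ?_
    have : sharp G (t, x) (LinearMap.toContinuousLinearMap ((prodFrame E).coord (Sum.inr i))) =
        (f t ^ 2)⁻¹ • (0, sharp h x (coframe E i)) := by
      rw [hW.sharp_eq ht hx]
      have h0 : LinearMap.toContinuousLinearMap ((prodFrame E).coord (Sum.inr i)) ∘L
          ContinuousLinearMap.inr ℝ ℝ E = coframe E i := by
        ext v; simp [prodFrame, coframe]
      rw [h0]
      simp [prodFrame]
    rw [this, hB.smul_right]
    simp [prodFrame]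

theorem scalar_eq (hW : IsWarpedOn G ε f h J Ω) (ht : t ∈ J) (hx : x ∈ Ω) :
    scalar G (t, x) = -(ε * (Module.finrank ℝ E * (deriv (deriv f) t / f t))) + (f t ^ 2)⁻¹ *
      (scalar h x - ε * (f t * deriv (deriv f) t
        + (Module.finrank ℝ E - 1) * deriv f t ^ 2) * Module.finrank ℝ E) := by
  rw [scalar, hW.metricTrace_eq ht hx (isBilin_ricci hW.isMetricOn (mem ht hx))]
  simp only [hW.ricci_eq ht hx]
  rw [metricTrace_sub, metricTrace_const_mul, metricTrace_metric hW.fiber hx, metricTrace_add]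
  simp only [mul_zero, metricTrace_zero, ← scalar.eq_def]
  have hz : ricci h x 0 0 = 0 := by simpa using (isBilin_ricci hW.fiber hx).smul_left 0 0 0
  simp [hz]

end IsWarpedOn

section fiber

variable (h : E → E →L[ℝ] E →L[ℝ] ℝ)

/-- The trace-free Ricci tensor. -/
def tfRicci (x v w : E) : ℝ := ricci h x v w - scalar h x / Module.finrank ℝ E * h x v w

/-- The Weyl tensor of type `(0,4)` of the product metric `dt² + h` on `ℝ × E`, restricted to
vectors tangent to `E`. -/
def cylWeyl (x u v w z : E) : ℝ :=
  let m : ℝ := Module.finrank ℝ E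
  h x (riem h x u v w) z
    + (1 / (m - 1)) * (ricci h x u w * h x v z - ricci h x v w * h x u z
      + h x u w * ricci h x v z - h x v w * ricci h x u z)
    - scalar h x / (m * (m - 1)) * (h x u w * h x v z - h x v w * h x u z)

end fiber

namespace IsWarpedOn

variable {G : ℝ × E → ℝ × E →L[ℝ] ℝ × E →L[ℝ] ℝ} {ε : ℝ} {f : ℝ → ℝ}
  {h : E → E →L[ℝ] E →L[ℝ] ℝ} {J : Set ℝ} {Ω : Set E} {t : ℝ} {x : E}

/-- The metric is conformal to ε ds² + h with ds = dt/f, and the Weyl tensor is conformally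
covariant. Hence f enters only as the factor f² of the fibre part, and the components along ∂_t see
nothing but the trace-free Ricci tensor of h. -/
theorem weylLow_eq (hW : IsWarpedOn G ε f h J Ω) (hm : 2 ≤ Module.finrank ℝ E) (ht : t ∈ J)
    (hx : x ∈ Ω) (u v w z : ℝ × E) :
    weylLow G (t, x) ![u, v, w, z] = f t ^ 2 * cylWeyl h x u.2 v.2 w.2 z.2
      - ε / (Module.finrank ℝ E - 1) * (v.1 * w.1 * tfRicci h x u.2 z.2
        - u.1 * w.1 * tfRicci h x v.2 z.2 - v.1 * z.1 * tfRicci h x u.2 w.2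
        + u.1 * z.1 * tfRicci h x v.2 w.2) := by
  have hf := hW.ne_zero ht
  have hy := mem ht hx
  have hM := hW.isMetricOn
  have hm' : (2 : ℝ) ≤ Module.finrank ℝ E := by exact_mod_cast hm
  have hd : (Module.finrank ℝ (ℝ × E) : ℝ) = Module.finrank ℝ E + 1 := by simp [add_comm]
  change G (t, x) (weyl G (t, x) u v w) z = _
  simp only [weyl, map_add, map_sub, map_smul, add_apply, sub_apply, smul_apply, smul_eq_mul,
    riemann_eq_riem hM hy, inner_ricciOp hM hy, hd, hW.scalar_eq ht hx]
  simp only [hW.eq t ht x hx, hW.riem_eq ht hx, hW.ricci_eq ht hx, map_add, map_sub, map_smul,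
    add_apply, sub_apply, smul_apply, smul_eq_mul, cylWeyl, tfRicci]
  generalize (Module.finrank ℝ E : ℝ) = m at *
  have h1 : m ≠ 0 := by linarith
  have h2 : m - 1 ≠ 0 := by linarith
  have h3 : m + 1 - 2 = m - 1 := by ring
  have h4 : m + 1 - 1 = m := by ring
  rw [h3, h4]
  rcases hW.sign with rfl | rfl <;> field_simp <;> ring

end IsWarpedOn

end CoordGeom

/-! ### Covariant derivatives of tensors and their traces -/

namespace CoordGeom

section covDeriv

variable {V : Type*} [NormedAddCommGroup V] [NormedSpace ℝ V] [FiniteDimensional ℝ V]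
  {G : V → V →L[ℝ] V →L[ℝ] ℝ} {Ω : Set V} {x : V}

theorem covDeriv_four (T : V → (Fin 4 → V) → ℝ) (x e a b c d : V) :
    covDeriv G T x ![e, a, b, c, d] = fderiv ℝ (fun y => T y ![a, b, c, d]) x e
      - T x ![chr G x e a, b, c, d] - T x ![a, chr G x e b, c, d]
      - T x ![a, b, chr G x e c, d] - T x ![a, b, c, chr G x e d] := by
  have ht : Fin.tail ![e, a, b, c, d] = ![a, b, c, d] := rfl
  have h0 : Function.update ![a, b, c, d] 0 (christoffel G x e a) = ![chr G x e a, b, c, d] := by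
    ext i; fin_cases i <;> simp [chr_apply]
  have h1 : Function.update ![a, b, c, d] 1 (christoffel G x e b) = ![a, chr G x e b, c, d] := by
    ext i; fin_cases i <;> simp [chr_apply]
  have h2 : Function.update ![a, b, c, d] 2 (christoffel G x e c) = ![a, b, chr G x e c, d] := by
    ext i; fin_cases i <;> simp [chr_apply]
  have h3 : Function.update ![a, b, c, d] 3 (christoffel G x e d) = ![a, b, c, chr G x e d] := by
    ext i; fin_cases i <;> simp [chr_apply]
  rw [covDeriv, ht, Fin.sum_univ_four]
  simp [h0, h1, h2, h3]
  ring

theorem covDeriv_five (T : V → (Fin 5 → V) → ℝ) (x e a b c d k : V) :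
    covDeriv G T x ![e, a, b, c, d, k] = fderiv ℝ (fun y => T y ![a, b, c, d, k]) x e
      - T x ![chr G x e a, b, c, d, k] - T x ![a, chr G x e b, c, d, k]
      - T x ![a, b, chr G x e c, d, k] - T x ![a, b, c, chr G x e d, k]
      - T x ![a, b, c, d, chr G x e k] := by
  have ht : Fin.tail ![e, a, b, c, d, k] = ![a, b, c, d, k] := rfl
  have h0 : Function.update ![a, b, c, d, k] 0 (christoffel G x e a) =
      ![chr G x e a, b, c, d, k] := by
    ext i; fin_cases i <;> simp [chr_apply]
  have h1 : Function.update ![a, b, c, d, k] 1 (christoffel G x e b) =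
      ![a, chr G x e b, c, d, k] := by
    ext i; fin_cases i <;> simp [chr_apply]
  have h2 : Function.update ![a, b, c, d, k] 2 (christoffel G x e c) =
      ![a, b, chr G x e c, d, k] := by
    ext i; fin_cases i <;> simp [chr_apply]
  have h3 : Function.update ![a, b, c, d, k] 3 (christoffel G x e d) =
      ![a, b, c, chr G x e d, k] := by
    ext i; fin_cases i <;> simp [chr_apply]
  have h4 : Function.update ![a, b, c, d, k] 4 (christoffel G x e k) =
      ![a, b, c, d, chr G x e k] := by
    ext i; fin_cases i <;> simp [chr_apply]
  rw [covDeriv, ht, Fin.sum_univ_five]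
  simp [h0, h1, h2, h3, h4]
  ring

/-- The inverse metric is parallel. -/
theorem hasFDerivAt_sharp_apply (hG : IsMetricOn G Ω) (hx : x ∈ Ω) (α : V →L[ℝ] ℝ) :
    ∃ L : V →L[ℝ] V, HasFDerivAt (fun y => sharp G y α) L x ∧
      ∀ c, L c = - chr G x c (sharp G x α) - sharp G x (α ∘L chr G x c) := by
  have hd : DifferentiableAt ℝ (fun y => sharp G y α) x :=
    (((contDiffOn_sharp hG).clm_apply contDiffOn_const).differentiableOn
      (by simp)).differentiableAt (hG.isOpen.mem_nhds hx)
  refine ⟨_, hd.hasFDerivAt, fun c => eq_of_forall_inner hG hx fun z => ?_⟩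
  have e1 : (fun y => G y (sharp G y α) z) =ᶠ[𝓝 x] fun _ => α z := by
    filter_upwards [hG.isOpen.mem_nhds hx] with y hy using flat_sharp_apply hG hy α z
  have e2 := ((differentiableAt_metric hG hx).hasFDerivAt.clm_apply hd.hasFDerivAt).clm_apply
    (hasFDerivAt_const z x)
  have e3 := congrArg (fun L => L c)
    ((e2.congr_of_eventuallyEq e1.symm).unique (hasFDerivAt_const (α z) x))
  simp [fderiv_metric hG hx, flat_sharp_apply hG hx] at e3
  simp [flat_sharp_apply hG hx]
  linarith

theorem sharp_coframe_eq_sum (x : V) (i : Fin (Module.finrank ℝ V)) : sharp G x (coframe V i) =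
    ∑ j, coframe V j (sharp G x (coframe V i)) • frame V j := (sum_coframe_smul _).symm

/-- Metric traces commute with covariant derivatives; here in the form that the covariant
derivative of a tensor with vanishing trace has vanishing trace. -/
theorem metricTrace_covDeriv_eq_zero (hG : IsMetricOn G Ω) (hx : x ∈ Ω)
    {T : V → (Fin 5 → V) → ℝ}
    (hbil : ∀ y ∈ Ω, ∀ a b c, IsBilin fun p q => T y ![p, a, b, c, q])
    (hdiff : ∀ a b c p q, DifferentiableAt ℝ (fun y => T y ![p, a, b, c, q]) x)
    (htr : ∀ y ∈ Ω, ∀ a b c, metricTrace G y (fun p q => T y ![p, a, b, c, q]) = 0)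
    (e a b c : V) :
    metricTrace G x (fun p q => covDeriv G T x ![e, p, a, b, c, q]) = 0 := by
  choose L hL hL' using fun i => hasFDerivAt_sharp_apply hG hx (coframe V i)
  have hb := hbil x hx a b c
  have expand : ∀ y ∈ Ω, ∀ a b c, metricTrace G y (fun p q => T y ![p, a, b, c, q]) =
      ∑ i, ∑ j, coframe V j (sharp G y (coframe V i)) * T y ![frame V i, a, b, c, frame V j] := by
    intro y hy a b c
    rw [metricTrace]
    refine Finset.sum_congr rfl fun i _ => ?_
    conv_lhs => rw [sharp_coframe_eq_sum]
    exact (hbil y hy a b c).sum_right Finset.univ _ _ _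
  -- In the fixed frame the vanishing trace reads g^{ij} T_{i…j} = 0 near x. Its derivative vanishes
  -- too, and the derivative of g^{ij} supplies the two Christoffel corrections in the contracted
  -- slots.
  have e1 : (fun y => ∑ i, ∑ j, coframe V j (sharp G y (coframe V i)) *
      T y ![frame V i, a, b, c, frame V j]) =ᶠ[𝓝 x] fun _ => 0 := by
    filter_upwards [hG.isOpen.mem_nhds hx] with y hy
    rw [← expand y hy a b c, htr y hy]
  have e2 : HasFDerivAt (fun y => ∑ i, ∑ j, coframe V j (sharp G y (coframe V i)) *
      T y ![frame V i, a, b, c, frame V j]) _ x :=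
    HasFDerivAt.fun_sum fun i _ => HasFDerivAt.fun_sum fun j _ =>
      ((coframe V j).hasFDerivAt.comp x (hL i)).mul
        (hdiff a b c (frame V i) (frame V j)).hasFDerivAt
  have e3 := congrArg (fun L => L e) ((e2.congr_of_eventuallyEq e1.symm).unique
    (hasFDerivAt_const (0 : ℝ) x))
  simp only [sum_apply, add_apply, smul_apply, ContinuousLinearMap.comp_apply, smul_eq_mul,
    zero_apply, Function.comp_apply, Finset.sum_add_distrib, hL'] at e3
  -- the derivative of the inverse metric
  have e4 : ∑ i, ∑ j, T x ![frame V i, a, b, c, frame V j] * coframe V j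
      (- chr G x e (sharp G x (coframe V i)) - sharp G x (coframe V i ∘L chr G x e)) =
      - metricTrace G x (fun p q => T x ![p, a, b, c, chr G x e q])
      - metricTrace G x (fun p q => T x ![chr G x e p, a, b, c, q]) := by
    have k1 : ∀ i, ∑ j, T x ![frame V i, a, b, c, frame V j] * coframe V j
        (- chr G x e (sharp G x (coframe V i)) - sharp G x (coframe V i ∘L chr G x e)) =
        - T x ![frame V i, a, b, c, chr G x e (sharp G x (coframe V i))]
        - T x ![frame V i, a, b, c, sharp G x (coframe V i ∘L chr G x e)] := by
      intro i
      have s := fun w => hb.sum_right Finset.univ (fun j => coframe V j w) (frame V) (frame V i)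
      simp only [sum_coframe_smul] at s
      rw [s, s, ← Finset.sum_neg_distrib, ← Finset.sum_sub_distrib]
      refine Finset.sum_congr rfl fun j _ => ?_
      rw [map_sub, map_neg]
      ring
    have k2 : ∑ i, T x ![frame V i, a, b, c, sharp G x (coframe V i ∘L chr G x e)] =
        metricTrace G x (fun p q => T x ![chr G x e p, a, b, c, q]) := by
      have l1 : ∀ i, T x ![frame V i, a, b, c, sharp G x (coframe V i ∘L chr G x e)] =
          ∑ k, coframe V i (chr G x e (frame V k)) *
            T x ![frame V i, a, b, c, sharp G x (coframe V k)] := by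
        intro i
        have : sharp G x (coframe V i ∘L chr G x e) =
            ∑ k, coframe V i (chr G x e (frame V k)) • sharp G x (coframe V k) := by
          conv_lhs => rw [← sum_apply_smul_coframe (coframe V i ∘L chr G x e)]
          simp
        rw [this]
        exact hb.sum_right Finset.univ _ _ _
      have l2 : ∀ k, T x ![chr G x e (frame V k), a, b, c, sharp G x (coframe V k)] =
          ∑ i, coframe V i (chr G x e (frame V k)) *
            T x ![frame V i, a, b, c, sharp G x (coframe V k)] := by
        intro k
        have := hb.sum_left Finset.univ (fun i => coframe V i (chr G x e (frame V k))) (frame V)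
          (sharp G x (coframe V k))
        rw [sum_coframe_smul] at this
        exact this
      simp only [metricTrace, l1, l2]
      exact Finset.sum_comm
    simp only [k1, Finset.sum_sub_distrib, Finset.sum_neg_distrib, k2]
    rfl
  have e5 : metricTrace G x (fun p q => fderiv ℝ (fun y => T y ![p, a, b, c, q]) x e) =
      ∑ i, ∑ j, coframe V j (sharp G x (coframe V i)) *
        fderiv ℝ (fun y => T y ![frame V i, a, b, c, frame V j]) x e := by
    refine Finset.sum_congr rfl fun i _ => ?_
    have : (fun y => T y ![frame V i, a, b, c, sharp G x (coframe V i)]) =ᶠ[𝓝 x]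
        fun y => ∑ j, coframe V j (sharp G x (coframe V i)) *
          T y ![frame V i, a, b, c, frame V j] := by
      filter_upwards [hG.isOpen.mem_nhds hx] with y hy
      conv_lhs => rw [sharp_coframe_eq_sum]
      exact (hbil y hy a b c).sum_right Finset.univ _ _ _
    have h1 : HasFDerivAt (fun y => ∑ j, coframe V j (sharp G x (coframe V i)) *
          T y ![frame V i, a, b, c, frame V j]) _ x :=
      HasFDerivAt.fun_sum fun j _ => (hdiff a b c (frame V i) (frame V j)).hasFDerivAt.const_mul _
    simp only
    rw [this.fderiv_eq, h1.fderiv]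
    simp
  simp only [covDeriv_five, metricTrace_sub]
  -- The corrections in the three free slots are themselves traces of T.
  rw [htr x hx, htr x hx, htr x hx, e5]
  linarith

theorem metricTrace_swap (hG : IsMetricOn G Ω) (hx : x ∈ Ω) {B : V → V → ℝ} (hB : IsBilin B) :
    metricTrace G x (fun v w => B w v) = metricTrace G x B := by
  have h1 : metricTrace G x B =
      ∑ i, ∑ j, coframe V j (sharp G x (coframe V i)) * B (frame V i) (frame V j) := by
    refine Finset.sum_congr rfl fun i _ => ?_
    conv_lhs => rw [sharp_coframe_eq_sum]
    exact hB.sum_right Finset.univ _ _ _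
  have h2 : metricTrace G x (fun v w => B w v) =
      ∑ i, ∑ j, coframe V j (sharp G x (coframe V i)) * B (frame V j) (frame V i) := by
    refine Finset.sum_congr rfl fun i _ => ?_
    conv_lhs => rw [sharp_coframe_eq_sum]
    exact hB.sum_left Finset.univ _ _ _
  rw [h1, h2, Finset.sum_comm]
  refine Finset.sum_congr rfl fun i _ => Finset.sum_congr rfl fun j _ => ?_
  rw [← flat_sharp_apply hG hx (coframe V i), flat_sharp_apply' hG hx]

theorem metricTrace_neg (B : V → V → ℝ) :
    metricTrace G x (fun v w => - B v w) = - metricTrace G x B := by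
  simp [metricTrace]

theorem metricTrace_eq_zero_of_antisymm (hG : IsMetricOn G Ω) (hx : x ∈ Ω) {B : V → V → ℝ}
    (hB : IsBilin B) (h : ∀ v w, B v w = - B w v) : metricTrace G x B = 0 := by
  have h1 := metricTrace_swap hG hx hB
  have h2 : metricTrace G x B = - metricTrace G x (fun v w => B w v) := by
    rw [← metricTrace_neg]
    exact metricTrace_congr h
  linarith

theorem contDiffOn_scalar (hG : IsMetricOn G Ω) : ContDiffOn ℝ ∞ (scalar G) Ω := by
  have hS := contDiffOn_sharp hG
  have hr := fun v w => contDiffOn_ricci hG v w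
  refine ContDiffOn.congr (f := fun x => ∑ i, ∑ j, coframe V j (sharp G x (coframe V i)) *
    ricci G x (frame V i) (frame V j)) ?_ fun x hx => ?_
  · refine ContDiffOn.sum fun i _ => ContDiffOn.sum fun j _ => ContDiffOn.mul ?_ (hr _ _)
    fun_prop
  · rw [scalar, metricTrace]
    refine Finset.sum_congr rfl fun i _ => ?_
    conv_lhs => rw [sharp_coframe_eq_sum]
    exact (isBilin_ricci hG hx).sum_right Finset.univ _ _ _

end covDeriv

end CoordGeom

/-! ### The divergence of the Weyl tensor of a warped product -/

namespace CoordGeom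

variable {E : Type*} [NormedAddCommGroup E] [NormedSpace ℝ E] [FiniteDimensional ℝ E]

section fiber

variable {h : E → E →L[ℝ] E →L[ℝ] ℝ} {Ω : Set E} {x : E}

theorem isBilin_tfRicci (hh : IsMetricOn h Ω) (hx : x ∈ Ω) : IsBilin (tfRicci h x) := by
  have hr := isBilin_ricci hh hx
  constructor <;> intros <;>
    simp [tfRicci, hr.add_left, hr.add_right, hr.smul_left, hr.smul_right] <;> ring

theorem IsBilin.zero_left {B : E → E → ℝ} (hB : IsBilin B) (w : E) : B 0 w = 0 := by
  simpa using hB.smul_left 0 0 w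

theorem IsBilin.zero_right {B : E → E → ℝ} (hB : IsBilin B) (w : E) : B w 0 = 0 := by
  simpa using hB.smul_right 0 w 0

theorem isBilin_cylWeyl (hh : IsMetricOn h Ω) (hx : x ∈ Ω) (v w : E) :
    IsBilin fun u z => cylWeyl h x u v w z := by
  have hr := isBilin_ricci hh hx
  constructor <;> intros <;>
    simp [cylWeyl, hr.add_left, hr.add_right, hr.smul_left, hr.smul_right] <;> ring

/-- The Weyl tensor of the cylinder is trace-free, so its trace over the fibre is minus its (∂_t, v,
w, ∂_t) component. -/
theorem metricTrace_cylWeyl (hh : IsMetricOn h Ω) (hx : x ∈ Ω)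
    (hm : 2 ≤ Module.finrank ℝ E) (v w : E) :
    metricTrace h x (fun u z => cylWeyl h x u v w z) =
      tfRicci h x v w / (Module.finrank ℝ E - 1) := by
  have hm' : (2 : ℝ) ≤ Module.finrank ℝ E := by exact_mod_cast hm
  have hr := isBilin_ricci hh hx
  have h1 : (fun u z => cylWeyl h x u v w z) = fun u z => h x (riem h x u v w) z
      + (1 / ((Module.finrank ℝ E : ℝ) - 1)) * (ricci h x u w * h x v z - ricci h x v w * h x u z
      + (ricci h x v z * h x u w - h x v w * ricci h x u z))
      - scalar h x / (Module.finrank ℝ E * (Module.finrank ℝ E - 1)) *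
        (h x u w * h x v z - h x v w * h x u z) := by
    funext u z
    simp only [cylWeyl]
    ring
  rw [h1, metricTrace_sub, metricTrace_add, metricTrace_const_mul, metricTrace_const_mul,
    metricTrace_sub, metricTrace_add, metricTrace_sub, metricTrace_sub,
    metricTrace_const_mul, metricTrace_const_mul, metricTrace_const_mul,
    metricTrace_mul_inner_left hh hx hr,
    metricTrace_mul_inner_right hh hx hr, metricTrace_mul_inner_right hh hx (isBilin_clm (h x)),
    metricTrace_metric hh hx, ← ricci_eq_metricTrace hh hx, tfRicci]
  have h2 : metricTrace h x (fun v w => ricci h x v w) = scalar h x := rfl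
  rw [h2]
  generalize (Module.finrank ℝ E : ℝ) = m at *
  have h1 : m ≠ 0 := by linarith
  have h2 : m - 1 ≠ 0 := by linarith
  field_simp
  ring

theorem differentiableAt_tfRicci (hh : IsMetricOn h Ω) (hx : x ∈ Ω) (v w : E) :
    DifferentiableAt ℝ (fun y => tfRicci h y v w) x := by
  have h1 := (contDiffOn_ricci hh v w).contDiffAt (hh.isOpen.mem_nhds hx)
  have h2 := (contDiffOn_scalar hh).contDiffAt (hh.isOpen.mem_nhds hx)
  have h3 := (hh.smooth.contDiffAt (hh.isOpen.mem_nhds hx)).clm_apply (contDiffAt_const (c := v))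
  have h4 := h3.clm_apply (contDiffAt_const (c := w))
  have d1 : DifferentiableAt ℝ (fun y => ricci h y v w) x := h1.differentiableAt (by simp)
  have d2 : DifferentiableAt ℝ (fun y => scalar h y) x := h2.differentiableAt (by simp)
  have d4 : DifferentiableAt ℝ (fun y => h y v w) x := h4.differentiableAt (by simp)
  simp only [tfRicci, div_eq_mul_inv]
  exact d1.fun_sub ((d2.mul_const _).fun_mul d4)

end fiber

namespace IsWarpedOn

variable {G : ℝ × E → ℝ × E →L[ℝ] ℝ × E →L[ℝ] ℝ} {ε : ℝ} {f : ℝ → ℝ}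
  {h : E → E →L[ℝ] E →L[ℝ] ℝ} {J : Set ℝ} {Ω : Set E} {t : ℝ} {x : E}

/-- The component of the divergence of the Weyl tensor that detects the trace-free Ricci tensor
of the fibre. -/
theorem divWeyl_eq (hW : IsWarpedOn G ε f h J Ω) (hm : 2 ≤ Module.finrank ℝ E) (ht : t ∈ J)
    (hx : x ∈ Ω) (v w : E) : divWeyl G (t, x) (1, 0) (0, v) (0, w) =
      (2 - Module.finrank ℝ E) / (Module.finrank ℝ E - 1) * (deriv f t / f t) *
        tfRicci h x v w := by
  have hf := hW.ne_zero ht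
  have hZ := isBilin_tfRicci hW.fiber hx
  have hA := isBilin_cylWeyl hW.fiber hx v w
  have hA0 : ∀ y ∈ Ω, ∀ v w z, cylWeyl h y 0 v w z = 0 := fun y hy v w z =>
    (isBilin_cylWeyl hW.fiber hy v w).zero_left z
  -- With ∂_t in the first slot the Weyl tensor is −ε/(m − 1) q₁ Z(v, w). The `cylWeyl` term arises
  -- because ∇ turns ∂_t into a fibre vector; the terms with h(p, w) and h(p, q) arise because it
  -- turns fibre vectors into multiples of ∂_t.
  have formula : ∀ p q : ℝ × E,
      covDeriv G (weylLow G) (t, x) ![p, (1, 0), (0, v), (0, w), q] =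
      -(ε / (Module.finrank ℝ E - 1)) * q.1 * fderiv ℝ (fun y => tfRicci h y v w) x p.2
      - f t ^ 2 * (deriv f t / f t) * cylWeyl h x p.2 v w q.2
      + ε / (Module.finrank ℝ E - 1) * q.1 *
        (tfRicci h x (chr h x p.2 v) w + deriv f t / f t * p.1 * tfRicci h x v w)
      + ε / (Module.finrank ℝ E - 1) * (q.1 *
        (tfRicci h x v (chr h x p.2 w) + deriv f t / f t * p.1 * tfRicci h x v w)
        + ε * f t * deriv f t * h x p.2 w * tfRicci h x v q.2)
      - (ε / (Module.finrank ℝ E - 1)) * ε * f t * deriv f t * h x p.2 q.2 * tfRicci h x v w := by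
    intro p q
    have e1 : (fun y => weylLow G y ![(1, 0), (0, v), (0, w), q]) =ᶠ[𝓝 (t, x)]
        fun y => -(ε / (Module.finrank ℝ E - 1)) * q.1 * tfRicci h y.2 v w := by
      filter_upwards [hW.isMetricOn.isOpen.mem_nhds (mem ht hx)] with y hy
      rw [← Prod.mk.eta (p := y), hW.weylLow_eq hm hy.1 hy.2]
      simp only [hA0 y.2 hy.2]
      ring
    have e2 := ((differentiableAt_tfRicci hW.fiber hx v w).hasFDerivAt.comp_snd
      (t := t)).const_mul (-(ε / (Module.finrank ℝ E - 1)) * q.1)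
    rw [covDeriv_four, e1.fderiv_eq, e2.fderiv]
    simp only [hW.weylLow_eq hm ht hx, hW.chr_eq ht hx]
    simp [hZ.zero_left, hZ.add_left, hZ.add_right, hZ.smul_left, hZ.smul_right,
      hA.smul_left, hA0 x hx]
    ring
  have hB : IsBilin fun p q =>
      covDeriv G (weylLow G) (t, x) ![p, (1, 0), (0, v), (0, w), q] := by
    have a1 := hA.add_left
    have a2 := hA.add_right
    have a3 := hA.smul_left
    have a4 := hA.smul_right
    constructor <;> intros <;>
      simp [formula, hZ.add_left, hZ.add_right, hZ.smul_left, hZ.smul_right, a1, a2, a3, a4] <;>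
      ring
  -- The base direction contributes 2/(m − 1) · (f'/f) Z(v, w) and the fibre trace −m/(m − 1) ·
  -- (f'/f) Z(v, w), whence the factor 2 − m.
  rw [divWeyl, hW.metricTrace_eq ht hx hB]
  simp only [formula]
  have e3 : (fun p q : E => -(ε / ((Module.finrank ℝ E : ℝ) - 1)) * 0 *
      fderiv ℝ (fun y => tfRicci h y v w) x p
      - f t ^ 2 * (deriv f t / f t) * cylWeyl h x p v w q
      + ε / (Module.finrank ℝ E - 1) * 0 *
        (tfRicci h x (chr h x p v) w + deriv f t / f t * 0 * tfRicci h x v w)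
      + ε / (Module.finrank ℝ E - 1) * (0 *
        (tfRicci h x v (chr h x p w) + deriv f t / f t * 0 * tfRicci h x v w)
        + ε * f t * deriv f t * h x p w * tfRicci h x v q)
      - (ε / (Module.finrank ℝ E - 1)) * ε * f t * deriv f t * h x p q * tfRicci h x v w) = fun p q =>
      (f t * deriv f t / (Module.finrank ℝ E - 1)) * (tfRicci h x v q * h x p w)
      - (f t * deriv f t / (Module.finrank ℝ E - 1) * tfRicci h x v w) * h x p q
      - f t * deriv f t * cylWeyl h x p v w q := by
    funext p q
    rcases hW.sign with rfl | rfl <;> field_simp <;> ring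
  rw [e3, metricTrace_sub, metricTrace_sub, metricTrace_const_mul, metricTrace_const_mul,
    metricTrace_const_mul, metricTrace_mul_inner_left hW.fiber hx hZ,
    metricTrace_metric hW.fiber hx, metricTrace_cylWeyl hW.fiber hx hm]
  simp only [hZ.zero_right, map_zero, hA.zero_right]
  simp [hZ.zero_left, hZ.zero_right]
  have hm' : (2 : ℝ) ≤ Module.finrank ℝ E := by exact_mod_cast hm
  generalize (Module.finrank ℝ E : ℝ) = m at *
  have h2 : m - 1 ≠ 0 := by linarith
  rcases hW.sign with rfl | rfl <;> field_simp <;> ring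

end IsWarpedOn

/-! ### Consequences of an Einstein fibre -/

section einstein

variable {h : E → E →L[ℝ] E →L[ℝ] ℝ} {Ω : Set E} {x : E} {ρ : E → ℝ}

theorem scalar_of_einstein (hh : IsMetricOn h Ω) (hx : x ∈ Ω)
    (hE : ∀ v w, ricci h x v w = ρ x * h x v w) : scalar h x = ρ x * Module.finrank ℝ E := by
  rw [scalar, metricTrace_congr hE, metricTrace_const_mul, metricTrace_metric hh hx]

theorem tfRicci_of_einstein (hh : IsMetricOn h Ω) (hx : x ∈ Ω) (hm : 2 ≤ Module.finrank ℝ E)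
    (hE : ∀ v w, ricci h x v w = ρ x * h x v w) (v w : E) : tfRicci h x v w = 0 := by
  have : (Module.finrank ℝ E : ℝ) ≠ 0 := by
    have : (2 : ℝ) ≤ Module.finrank ℝ E := by exact_mod_cast hm
    linarith
  rw [tfRicci, hE, scalar_of_einstein hh hx hE]
  field_simp
  ring

/-- For an Einstein fibre `cylWeyl` becomes the Weyl tensor of the fibre itself: the curvature minus
the part of constant curvature ρ/(m − 1). -/
theorem cylWeyl_of_einstein (hh : IsMetricOn h Ω) (hx : x ∈ Ω) (hm : 2 ≤ Module.finrank ℝ E)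
    (hE : ∀ v w, ricci h x v w = ρ x * h x v w) (u v w z : E) :
    cylWeyl h x u v w z = h x (riem h x u v w) z
      - ρ x / (Module.finrank ℝ E - 1) * (h x v w * h x u z - h x u w * h x v z) := by
  simp only [cylWeyl, hE, scalar_of_einstein hh hx hE]
  have hm' : (2 : ℝ) ≤ Module.finrank ℝ E := by exact_mod_cast hm
  generalize (Module.finrank ℝ E : ℝ) = m at *
  have h1 : m ≠ 0 := by linarith
  have h2 : m - 1 ≠ 0 := by linarith
  field_simp
  ring

theorem cylWeyl_antisymm_left (u v w z : E) : cylWeyl h x u v w z = - cylWeyl h x v u w z := by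
  simp only [cylWeyl, riem_antisymm x u v]
  simp
  ring

/-- By Schur's lemma ρ is locally constant, and h is parallel, so the covariant derivative of
`cylWeyl` is that of the curvature tensor. -/
theorem hasFDerivAt_cylWeyl (hh : IsMetricOn h Ω) (hx : x ∈ Ω) (hm : 3 ≤ Module.finrank ℝ E)
    (hE : ∀ y ∈ Ω, ∀ v w, ricci h y v w = ρ y * h y v w) (u v w z : E) :
    ∃ L : E →L[ℝ] ℝ, HasFDerivAt (fun y => cylWeyl h y u v w z) L x ∧
      ∀ e, L e = h x (nablaRiem h x e u v w) z + cylWeyl h x (chr h x e u) v w z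
        + cylWeyl h x u (chr h x e v) w z + cylWeyl h x u v (chr h x e w) z
        + cylWeyl h x u v w (chr h x e z) := by
  have hA := cylWeyl_of_einstein hh hx (by omega) (hE x hx)
  have e1 : (fun y => cylWeyl h y u v w z) =ᶠ[𝓝 x] fun y => h y (riem h y u v w) z
      - ρ x / (Module.finrank ℝ E - 1) * (h y v w * h y u z - h y u w * h y v z) := by
    filter_upwards [hh.isOpen.mem_nhds hx, einstein_factor_eventually_eq hh hx hm hE] with y hy hρ
    rw [cylWeyl_of_einstein hh hy (by omega) (hE y hy), hρ]
  have d := fun a b => hasFDerivAt_metric_apply hh hx a b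
  have e2 := (((differentiableAt_metric hh hx).hasFDerivAt.clm_apply
    (hasFDerivAt_riem_apply hh hx u v w)).clm_apply (hasFDerivAt_const z x)).sub
    ((((d v w).mul (d u z)).sub ((d u w).mul (d v z))).const_mul
      (ρ x / (Module.finrank ℝ E - 1)))
  refine ⟨_, e2.congr_of_eventuallyEq e1, fun e => ?_⟩
  simp [hA, nablaRiem, fderiv_metric hh hx]
  ring

end einstein

end CoordGeom

/-! ### Harmonic Weyl tensor and Bach-flatness for an Einstein fibre -/

namespace CoordGeom

variable {E : Type*} [NormedAddCommGroup E] [NormedSpace ℝ E] [FiniteDimensional ℝ E]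

theorem differentiableAt_nablaRiem {h : E → E →L[ℝ] E →L[ℝ] ℝ} {Ω : Set E} {x : E}
    (hh : IsMetricOn h Ω) (hx : x ∈ Ω) (e u v w : E) :
    DifferentiableAt ℝ (fun y => nablaRiem h y e u v w) x := by
  have hR := differentiableAt_riem hh hx
  have hc := differentiableAt_chr hh hx
  have hdR : DifferentiableAt ℝ (fderiv ℝ (riem h)) x :=
    ((contDiffOn_fderiv_of hh.isOpen (contDiffOn_riem hh)).differentiableOn
      (by simp)).differentiableAt (hh.isOpen.mem_nhds hx)
  simp only [nablaRiem, add_apply, sub_apply, ContinuousLinearMap.comp_apply]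
  fun_prop

theorem nablaRiem_add_left {h : E → E →L[ℝ] E →L[ℝ] ℝ} {x : E} (e e' u v : E) :
    nablaRiem h x (e + e') u v = nablaRiem h x e u v + nablaRiem h x e' u v := by
  ext w
  simp [nablaRiem]
  abel

theorem nablaRiem_smul_left {h : E → E →L[ℝ] E →L[ℝ] ℝ} {x : E} (c : ℝ) (e u v : E) :
    nablaRiem h x (c • e) u v = c • nablaRiem h x e u v := by
  ext w
  simp [nablaRiem, smul_sub, smul_add]

/-- The coefficient of the metric in the Ricci tensor of `ε dt² + f(t)² h`, if the Ricci tensor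
of the `m`-dimensional metric `h` is `r • h`. -/
def ricciFactor (m ε : ℝ) (f : ℝ → ℝ) (r t : ℝ) : ℝ :=
  (r - ε * (f t * deriv (deriv f) t + (m - 1) * deriv f t ^ 2)) / f t ^ 2

namespace IsWarpedOn

variable {G : ℝ × E → ℝ × E →L[ℝ] ℝ × E →L[ℝ] ℝ} {ε : ℝ} {f : ℝ → ℝ}
  {h : E → E →L[ℝ] E →L[ℝ] ℝ} {J : Set ℝ} {Ω : Set E} {t : ℝ} {x : E} {ρ : E → ℝ}

theorem weylLow_of_einstein (hW : IsWarpedOn G ε f h J Ω) (hm : 2 ≤ Module.finrank ℝ E)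
    (hE : ∀ y ∈ Ω, ∀ v w, ricci h y v w = ρ y * h y v w) (ht : t ∈ J) (hx : x ∈ Ω)
    (u v w z : ℝ × E) :
    weylLow G (t, x) ![u, v, w, z] = f t ^ 2 * cylWeyl h x u.2 v.2 w.2 z.2 := by
  rw [hW.weylLow_eq hm ht hx]
  simp [tfRicci_of_einstein hW.fiber hx hm (hE x hx)]

theorem weyl_dt (hW : IsWarpedOn G ε f h J Ω) (hm : 2 ≤ Module.finrank ℝ E)
    (hE : ∀ y ∈ Ω, ∀ v w, ricci h y v w = ρ y * h y v w) (ht : t ∈ J) (hx : x ∈ Ω)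
    (u v : ℝ × E) : weyl G (t, x) u v (1, 0) = 0 := by
  refine hW.isMetricOn.nondegenerate _ (mem ht hx) _ fun z => ?_
  have := hW.weylLow_of_einstein hm hE ht hx u v (1, 0) z
  rw [cylWeyl_of_einstein hW.fiber hx hm (hE x hx)] at this
  simpa [weylLow] using this

/-- The covariant derivative of the Weyl tensor, for an Einstein fibre. -/
theorem covDeriv_weylLow (hW : IsWarpedOn G ε f h J Ω) (hm : 3 ≤ Module.finrank ℝ E)
    (hE : ∀ y ∈ Ω, ∀ v w, ricci h y v w = ρ y * h y v w) (ht : t ∈ J) (hx : x ∈ Ω)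
    (p u v w q : ℝ × E) :
    covDeriv G (weylLow G) (t, x) ![p, u, v, w, q] =
      f t ^ 2 * h x (nablaRiem h x p.2 u.2 v.2 w.2) q.2
      - 2 * f t * deriv f t * p.1 * cylWeyl h x u.2 v.2 w.2 q.2
      - f t * deriv f t * (u.1 * cylWeyl h x p.2 v.2 w.2 q.2 + v.1 * cylWeyl h x u.2 p.2 w.2 q.2
        + w.1 * cylWeyl h x u.2 v.2 p.2 q.2 + q.1 * cylWeyl h x u.2 v.2 w.2 p.2) := by
  have hf := hW.ne_zero ht
  obtain ⟨L, hL, hL'⟩ := hasFDerivAt_cylWeyl hW.fiber hx hm hE u.2 v.2 w.2 q.2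
  have e1 : (fun y => weylLow G y ![u, v, w, q]) =ᶠ[𝓝 (t, x)]
      fun y => f y.1 * f y.1 * cylWeyl h y.2 u.2 v.2 w.2 q.2 := by
    filter_upwards [hW.isMetricOn.isOpen.mem_nhds (mem ht hx)] with y hy
    rw [← Prod.mk.eta (p := y), hW.weylLow_of_einstein (by omega) hE hy.1 hy.2]
    ring
  have d := (hW.hasDerivAt ht).comp_fst (x := x)
  have e2 := (d.mul d).mul (hL.comp_snd (t := t))
  rw [covDeriv_four, e1.fderiv_eq]
  erw [e2.fderiv]
  have hA := cylWeyl_of_einstein hW.fiber hx (by omega) (hE x hx)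
  simp only [hW.weylLow_of_einstein (by omega) hE ht hx, hW.chr_eq ht hx, add_apply, smul_apply,
    ContinuousLinearMap.comp_apply, hL', smul_eq_mul, ContinuousLinearMap.coe_snd',
    ContinuousLinearMap.coe_fst', Pi.mul_apply]
  simp only [hA, map_add, map_smul, add_apply, smul_apply, smul_eq_mul]
  field_simp
  ring

theorem isBilin_covDeriv_weylLow (hW : IsWarpedOn G ε f h J Ω) (hm : 3 ≤ Module.finrank ℝ E)
    (hE : ∀ y ∈ Ω, ∀ v w, ricci h y v w = ρ y * h y v w) (ht : t ∈ J) (hx : x ∈ Ω)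
    (u v w : ℝ × E) :
    IsBilin fun p q => covDeriv G (weylLow G) (t, x) ![p, u, v, w, q] := by
  simp only [hW.covDeriv_weylLow hm hE ht hx,
    cylWeyl_of_einstein hW.fiber hx (by omega) (hE x hx)]
  have hR := fun e e' u v => nablaRiem_add_left (h := h) (x := x) e e' u v
  have hR' := fun (c : ℝ) e u v => nablaRiem_smul_left (h := h) (x := x) c e u v
  constructor <;> intros <;> simp [hR, hR'] <;> ring

/-- The base direction contributes nothing, since every term then has a zero fibre argument. Over
the fibre, ∇R is divergence-free, and the warping terms are traces of `cylWeyl`: zero because Z = 0,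
or by skewness in the last two slots. -/
theorem metricTrace_covDeriv_weylLow (hW : IsWarpedOn G ε f h J Ω)
    (hm : 3 ≤ Module.finrank ℝ E)
    (hE : ∀ y ∈ Ω, ∀ v w, ricci h y v w = ρ y * h y v w) (ht : t ∈ J) (hx : x ∈ Ω)
    (u v w : ℝ × E) :
    metricTrace G (t, x) (fun p q => covDeriv G (weylLow G) (t, x) ![p, u, v, w, q]) = 0 := by
  rw [hW.metricTrace_eq ht hx (hW.isBilin_covDeriv_weylLow hm hE ht hx u v w)]
  simp only [hW.covDeriv_weylLow hm hE ht hx]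
  have hA := cylWeyl_of_einstein hW.fiber hx (by omega) (hE x hx)
  have hT : ∀ v w, metricTrace h x (fun p q => cylWeyl h x p v w q) = 0 := fun v w => by
    rw [metricTrace_cylWeyl hW.fiber hx (by omega),
      tfRicci_of_einstein hW.fiber hx (by omega) (hE x hx), zero_div]
  have hT2 : ∀ u w, metricTrace h x (fun p q => cylWeyl h x u p w q) = 0 := fun u w => by
    simp only [cylWeyl_antisymm_left u]
    rw [metricTrace_neg, hT, neg_zero]
  have hT3 : ∀ u v, metricTrace h x (fun p q => cylWeyl h x u v p q) = 0 := fun u v => by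
    refine metricTrace_eq_zero_of_antisymm hW.fiber hx ?_ fun p q => ?_
    · simp only [hA]
      constructor <;> intros <;> simp <;> ring
    · rw [hA, hA, inner_riem_antisymm hW.fiber hx]
      ring
  have hN : metricTrace h x (fun p q => h x (nablaRiem h x p u.2 v.2 w.2) q) = 0 := by
    rw [← sum_nablaRiem_of_einstein hW.fiber hx hm hE u.2 v.2 w.2]
    simp only [metricTrace, flat_sharp_apply' hW.fiber hx]
  have e : (fun p q : E => f t ^ 2 * h x (nablaRiem h x p u.2 v.2 w.2) q
      - 2 * f t * deriv f t * 0 * cylWeyl h x u.2 v.2 w.2 q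
      - f t * deriv f t * (u.1 * cylWeyl h x p v.2 w.2 q + v.1 * cylWeyl h x u.2 p w.2 q
        + w.1 * cylWeyl h x u.2 v.2 p q + 0 * cylWeyl h x u.2 v.2 w.2 p)) = fun p q =>
      f t ^ 2 * h x (nablaRiem h x p u.2 v.2 w.2) q
      - f t * deriv f t * (u.1 * cylWeyl h x p v.2 w.2 q + v.1 * cylWeyl h x u.2 p w.2 q
        + w.1 * cylWeyl h x u.2 v.2 p q) := by
    funext p q; ring
  rw [e, metricTrace_sub, metricTrace_const_mul, metricTrace_const_mul, metricTrace_add,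
    metricTrace_add, metricTrace_const_mul, metricTrace_const_mul, metricTrace_const_mul,
    hN, hT, hT2, hT3]
  simp [hA]

/-- The coefficient of dt ⊗ dt is Ric(∂_t, ∂_t) minus the ε `ricciFactor` already contained in the
multiple of G. -/
theorem ricci_of_einstein (hW : IsWarpedOn G ε f h J Ω) (ht : t ∈ J) (hx : x ∈ Ω) {r : ℝ}
    (hE : ∀ v w, ricci h x v w = r * h x v w) (v w : ℝ × E) :
    ricci G (t, x) v w = ricciFactor (Module.finrank ℝ E) ε f r t * G (t, x) v w
      + (-(Module.finrank ℝ E * (deriv (deriv f) t / f t))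
        - ε * ricciFactor (Module.finrank ℝ E) ε f r t) * (v.1 * w.1) := by
  have hf := hW.ne_zero ht
  rw [hW.ricci_eq ht hx, hE, hW.eq t ht x hx, ricciFactor]
  field_simp
  ring

/-- A warped product with one-dimensional base and Einstein fibre is Bach-flat, for every
normalization of the Bach tensor. -/
theorem bach_eq_zero (hW : IsWarpedOn G ε f h J Ω) (hm : 3 ≤ Module.finrank ℝ E)
    (hE : ∀ y ∈ Ω, ∀ v w, ricci h y v w = ρ y * h y v w) (ht : t ∈ J) (hx : x ∈ Ω)
    (κ : ℝ) (a b : ℝ × E) : bach κ G (t, x) a b = 0 := by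
  have hM := hW.isMetricOn
  have hy := mem ht hx
  -- The inner trace is a covariant derivative of ∇^d W_{cabd}, which vanishes identically near the
  -- point; so this term is zero whatever κ is.
  have h1 : ∀ c' c, metricTrace G (t, x) (fun d' d =>
      covDeriv G (covDeriv G (weylLow G)) (t, x) ![c', d', c, a, b, d]) = 0 := by
    intro c' c
    refine metricTrace_covDeriv_eq_zero hM hy
      (fun y hy u v w => hW.isBilin_covDeriv_weylLow hm hE hy.1 hy.2 u v w) ?_
      (fun y hy u v w => hW.metricTrace_covDeriv_weylLow hm hE hy.1 hy.2 u v w) c' c a b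
    intro u v w p q
    have e : (fun y => covDeriv G (weylLow G) y ![p, u, v, w, q]) =ᶠ[𝓝 (t, x)] fun y =>
        f y.1 ^ 2 * h y.2 (nablaRiem h y.2 p.2 u.2 v.2 w.2) q.2
        - 2 * f y.1 * deriv f y.1 * p.1 * cylWeyl h y.2 u.2 v.2 w.2 q.2
        - f y.1 * deriv f y.1 * (u.1 * cylWeyl h y.2 p.2 v.2 w.2 q.2
        + v.1 * cylWeyl h y.2 u.2 p.2 w.2 q.2
        + w.1 * cylWeyl h y.2 u.2 v.2 p.2 q.2 + q.1 * cylWeyl h y.2 u.2 v.2 w.2 p.2) := by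
      filter_upwards [hM.isOpen.mem_nhds hy] with y hy
      rw [← Prod.mk.eta (p := y), hW.covDeriv_weylLow hm hE hy.1 hy.2]
    refine DifferentiableAt.congr_of_eventuallyEq ?_ e
    have d1 : DifferentiableAt ℝ (fun y : ℝ × E => f y.1) (t, x) :=
      ((hW.hasDerivAt ht).comp_fst (x := x)).differentiableAt
    have d2 : DifferentiableAt ℝ (fun y : ℝ × E => deriv f y.1) (t, x) :=
      ((hW.hasDerivAt_deriv ht).comp_fst (x := x)).differentiableAt
    have dA : ∀ u v w z, DifferentiableAt ℝ (fun y : ℝ × E => cylWeyl h y.2 u v w z) (t, x) := by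
      intro u v w z
      obtain ⟨L, hL, -⟩ := hasFDerivAt_cylWeyl hW.fiber hx hm hE u v w z
      exact (hL.comp_snd (t := t)).differentiableAt
    have dN : DifferentiableAt ℝ
        (fun y : ℝ × E => h y.2 (nablaRiem h y.2 p.2 u.2 v.2 w.2) q.2) (t, x) := by
      have k := (((differentiableAt_metric hW.fiber hx).clm_apply
        (differentiableAt_nablaRiem hW.fiber hx p.2 u.2 v.2 w.2)).clm_apply
        (differentiableAt_const q.2))
      exact (k.hasFDerivAt.comp_snd (t := t)).differentiableAt
    have dA1 := dA u.2 v.2 w.2 q.2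
    have dA2 := dA p.2 v.2 w.2 q.2
    have dA3 := dA u.2 p.2 w.2 q.2
    have dA4 := dA u.2 v.2 p.2 q.2
    have dA5 := dA u.2 v.2 w.2 p.2
    exact (((d1.fun_pow 2).fun_mul dN).fun_sub ((((d1.const_mul 2).fun_mul d2).mul_const p.1).fun_mul
      dA1)).fun_sub ((d1.fun_mul d2).fun_mul ((((dA2.const_mul u.1).fun_add
      (dA3.const_mul v.1)).fun_add (dA4.const_mul w.1)).fun_add (dA5.const_mul q.1)))
  -- The metric part of Ric contracts W to a trace, which is zero; the dt² part inserts ∂_t into a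
  -- slot of W.
  have h2 : metricTrace G (t, x) (fun c' c => metricTrace G (t, x) fun d' d =>
      ricci G (t, x) c' d' * weylLow G (t, x) ![c, a, b, d]) = 0 := by
    obtain ⟨μ, ν, hr⟩ : ∃ μ ν : ℝ, ∀ v w : ℝ × E,
        ricci G (t, x) v w = μ * G (t, x) v w + ν * (v.1 * w.1) :=
      ⟨_, _, hW.ricci_of_einstein ht hx (hE x hx)⟩
    have hWl := hW.weylLow_of_einstein (by omega) hE ht hx
    have hA := isBilin_cylWeyl hW.fiber hx a.2 b.2
    have a1 := hA.add_left
    have a2 := hA.add_right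
    have a3 := hA.smul_left
    have a4 := hA.smul_right
    have hB : IsBilin fun c d => weylLow G (t, x) ![c, a, b, d] := by
      simp only [hWl]
      constructor <;> intros <;> simp [a1, a2, a3, a4] <;> ring
    -- Since dt = ε G(·, ∂_t), the dt² part can also be contracted through the metric.
    have hsign : ∀ w : ℝ × E, w.1 = ε * G (t, x) w (1, 0) := by
      intro w
      rw [hW.eq t ht x hx]
      simp
      rw [← mul_assoc, hW.sq_sign, one_mul]
    have inner : ∀ c' c, metricTrace G (t, x) (fun d' d =>
        ricci G (t, x) c' d' * weylLow G (t, x) ![c, a, b, d]) =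
        μ * weylLow G (t, x) ![c, a, b, c'] := by
      intro c' c
      have e : (fun d' d => ricci G (t, x) c' d' * weylLow G (t, x) ![c, a, b, d]) = fun d' d =>
          μ * (weylLow G (t, x) ![c, a, b, d] * G (t, x) d' c')
          + (ν * c'.1 * ε) * (weylLow G (t, x) ![c, a, b, d] * G (t, x) d' (1, 0)) := by
        funext d' d
        rw [hr, hM.symm _ hy c' d', hsign d']
        ring
      rw [e, metricTrace_add, metricTrace_const_mul, metricTrace_const_mul,
        metricTrace_mul_inner_left hM hy hB, metricTrace_mul_inner_left hM hy hB, hWl c a b (1, 0)]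
      have := hA.zero_right c.2
      simp [this]
    simp only [inner]
    rw [metricTrace_const_mul, metricTrace_swap hM hy hB, hW.metricTrace_eq ht hx hB]
    simp only [hWl]
    rw [metricTrace_const_mul, metricTrace_cylWeyl hW.fiber hx (by omega),
      tfRicci_of_einstein hW.fiber hx (by omega) (hE x hx)]
    have := hA.zero_right 0
    simp [this]
  rw [bach]
  simp only [h1, h2, metricTrace_zero]
  simp

end IsWarpedOn

end CoordGeom

/-! ### From coordinate expressions to the manifold -/

namespace SemiRiem

section General

variable {E : Type*} [NormedAddCommGroup E] [NormedSpace ℝ E]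
  {H : Type*} [TopologicalSpace H] {M : Type*} [TopologicalSpace M] [ChartedSpace H M]
  {I : ModelWithCorners ℝ E H} [I.Boundaryless] [IsManifold I 1 M]

theorem hasFDerivAt_tangentCoordChange {x y z : M}
    (h : z ∈ (extChartAt I x).source ∩ (extChartAt I y).source) :
    HasFDerivAt (extChartAt I y ∘ (extChartAt I x).symm) (tangentCoordChange I x y z)
      (extChartAt I x z) := by
  have := hasFDerivWithinAt_tangentCoordChange h
  rwa [I.range_eq_univ, hasFDerivWithinAt_univ] at this

/-- A tangent vector at q is given by its components in the preferred chart at q, so the derivative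
of the inverse chart at p is that of the transition from the chart at p to the chart at q. -/
theorem chartInvDeriv_eq (p : M) {y : E} (hy : y ∈ (extChartAt I p).target) :
    chartInvDeriv I p y =
      tangentCoordChange I p ((extChartAt I p).symm y) ((extChartAt I p).symm y) := by
  have hd : MDifferentiableAt 𝓘(ℝ, E) I (extChartAt I p).symm y :=
    ((contMDiffOn_extChartAt_symm (n := 1) p).contMDiffAt
      ((isOpen_extChartAt_target p).mem_nhds hy)).mdifferentiableAt (by simp)
  have hq : (extChartAt I p).symm y ∈ (extChartAt I p).source := (extChartAt I p).map_target hy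
  have h1 := hasFDerivAt_tangentCoordChange (I := I) (x := p) (y := (extChartAt I p).symm y)
    (z := (extChartAt I p).symm y) ⟨hq, mem_extChartAt_source _⟩
  rw [(extChartAt I p).right_inv hy] at h1
  have h2 : fderivWithin ℝ (writtenInExtChartAt 𝓘(ℝ, E) I y (extChartAt I p).symm)
      (Set.range 𝓘(ℝ, E)) (extChartAt 𝓘(ℝ, E) y y) =
      tangentCoordChange I p ((extChartAt I p).symm y) ((extChartAt I p).symm y) := by
    rw [modelWithCornersSelf_coe, Set.range_id, fderivWithin_univ]
    exact h1.fderiv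
  exact hd.mfderiv.trans h2

theorem inChart_apply (g : BilinField I M) (p : M) {y : E} {q : M}
    (hy : y ∈ (extChartAt I p).target) (hq : (extChartAt I p).symm y = q) (v w : E) :
    inChart g p y v w =
      modelForm (g q) (tangentCoordChange I p q q v) (tangentCoordChange I p q q w) := by
  subst hq
  rw [← chartInvDeriv_eq p hy]
  rfl

theorem inChart_base (g : BilinField I M) (p : M) (v w : E) :
    inChart g p (extChartAt I p p) v w = modelForm (g p) v w := by
  have hp := mem_extChartAt_source (I := I) p
  rw [inChart_apply g p (mem_extChartAt_target p) ((extChartAt I p).left_inv hp),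
    tangentCoordChange_self hp, tangentCoordChange_self hp]

theorem inChart_extChartAt (g : BilinField I M) (p : M) {q : M}
    (hq : q ∈ (extChartAt I p).source) (v w : E) :
    inChart g p (extChartAt I p q) v w =
      modelForm (g q) (tangentCoordChange I p q q v) (tangentCoordChange I p q q w) :=
  inChart_apply g p ((extChartAt I p).map_source hq) ((extChartAt I p).left_inv hq) v w

theorem modelForm_symm {g : BilinField I M} (hg : IsSemiRiemannianMetric g) (q : M) (v w : E) :
    modelForm (g q) v w = modelForm (g q) w v := hg.symm q v w

theorem modelForm_nondegenerate {g : BilinField I M} (hg : IsSemiRiemannianMetric g) (q : M)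
    (v : E) (hv : ∀ w, modelForm (g q) v w = 0) : v = 0 := hg.nondegenerate q v hv

theorem isMetricOn_inChart {g : BilinField I M} (hg : IsSemiRiemannianMetric g) (p : M) :
    CoordGeom.IsMetricOn (inChart g p) (extChartAt I p).target where
  isOpen := isOpen_extChartAt_target p
  smooth := hg.smooth p
  symm := fun y hy v w => by
    rw [inChart_apply g p hy rfl, inChart_apply g p hy rfl]
    exact modelForm_symm hg _ _ _
  nondegenerate := fun y hy v hv => by
    obtain ⟨q, hq⟩ : ∃ q, (extChartAt I p).symm y = q := ⟨_, rfl⟩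
    have hqp : q ∈ (extChartAt I p).source := hq ▸ (extChartAt I p).map_target hy
    have hqq : q ∈ (extChartAt I q).source := mem_extChartAt_source q
    have h1 : tangentCoordChange I p q q v = 0 := by
      refine modelForm_nondegenerate hg q _ fun w => ?_
      have := hv (tangentCoordChange I q p q w)
      rwa [inChart_apply g p hy hq, tangentCoordChange_comp ⟨⟨hqq, hqp⟩, hqq⟩,
        tangentCoordChange_self hqq] at this
    have h2 := tangentCoordChange_comp (I := I) (w := p) (x := q) (y := p) (v := v)
      ⟨⟨hqp, hqq⟩, hqp⟩
    rw [h1, map_zero, tangentCoordChange_self hqp] at h2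
    exact h2.symm

/-- The transition map between two preferred charts pulls back one coordinate expression of the
metric to the other. -/
theorem isPullbackOn_inChart [IsManifold I ∞ M] [FiniteDimensional ℝ E] {g : BilinField I M}
    (hg : IsSemiRiemannianMetric g) (p q : M) :
    CoordGeom.IsPullbackOn (inChart g q) (inChart g p) (extChartAt I q).target
      ((extChartAt I p).symm ≫ extChartAt I q).source
      (extChartAt I q ∘ (extChartAt I p).symm) := by
  have hsub : ((extChartAt I p).symm ≫ extChartAt I q).source ⊆ (extChartAt I p).target :=
    fun y hy => hy.1
  have hopen : IsOpen ((extChartAt I p).symm ≫ extChartAt I q).source := by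
    rw [PartialEquiv.trans_source]
    exact (continuousOn_extChartAt_symm p).isOpen_inter_preimage (isOpen_extChartAt_target p)
      (isOpen_extChartAt_source q)
  have hp := isMetricOn_inChart hg p
  refine ⟨isMetricOn_inChart hg q, ⟨hopen, hp.smooth.mono hsub, fun x hx => hp.symm x (hsub hx),
    fun x hx => hp.nondegenerate x (hsub hx)⟩, contDiffOn_ext_coord_change q p,
    fun y hy => (extChartAt I q).map_source hy.2, fun y hy v w => ?_⟩
  set r := (extChartAt I p).symm y with hr
  have hrp : r ∈ (extChartAt I p).source := (extChartAt I p).map_target hy.1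
  have hrq : r ∈ (extChartAt I q).source := hy.2
  have hrr : r ∈ (extChartAt I r).source := mem_extChartAt_source r
  have hyr : extChartAt I p r = y := (extChartAt I p).right_inv hy.1
  have hd := hasFDerivAt_tangentCoordChange (I := I) ⟨hrp, hrq⟩
  rw [hyr] at hd
  rw [hd.fderiv, Function.comp_apply, ← hr, inChart_extChartAt g q hrq,
    tangentCoordChange_comp ⟨⟨hrp, hrq⟩, hrr⟩, tangentCoordChange_comp ⟨⟨hrp, hrq⟩, hrr⟩,
    inChart_apply g p hy.1 hr.symm]

/-- If the Ricci tensor is pointwise a multiple of the metric, so it is in every chart. -/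
theorem ricci_inChart_of_pointwise [IsManifold I ∞ M] [FiniteDimensional ℝ E]
    {g : BilinField I M} (hg : IsSemiRiemannianMetric g) {r : M → ℝ}
    (hr : ∀ p v w, ricciAt g p v w = r p * g p v w) (p : M) :
    ∀ y ∈ (extChartAt I p).target, ∀ v w : E,
      CoordGeom.ricci (inChart g p) y v w = r ((extChartAt I p).symm y) * inChart g p y v w := by
  intro y hy v w
  -- The hypothesis at the point with coordinates y is formulated in the preferred chart of that
  -- point; naturality carries it to the chart at p.
  have h := isPullbackOn_inChart hg p ((extChartAt I p).symm y)
  have hy' : y ∈ ((extChartAt I p).symm ≫ extChartAt I ((extChartAt I p).symm y)).source :=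
    ⟨hy, mem_extChartAt_source _⟩
  rw [h.ricci_eq hy', h.eq y hy', Function.comp_apply, inChart_base]
  exact hr _ _ _

/-- Schur's lemma read in a chart. The manifold need not be connected, so only local constancy
follows. -/
theorem eventually_eq_of_pointwise [IsManifold I ∞ M] [FiniteDimensional ℝ E]
    {g : BilinField I M} (hg : IsSemiRiemannianMetric g) {r : M → ℝ}
    (hr : ∀ p v w, ricciAt g p v w = r p * g p v w) (hE : 3 ≤ Module.finrank ℝ E) (p : M) :
    ∀ᶠ q in 𝓝 p, r q = r p := by
  have h := CoordGeom.einstein_factor_eventually_eq (isMetricOn_inChart hg p)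
    (mem_extChartAt_target p) hE (ricci_inChart_of_pointwise hg hr p)
  filter_upwards [(continuousAt_extChartAt p).eventually h,
    (isOpen_extChartAt_source (I := I) p).mem_nhds (mem_extChartAt_source p)] with q hq hq'
  rwa [(extChartAt I p).left_inv hq', (extChartAt I p).left_inv (mem_extChartAt_source p)] at hq

end General

/-! ### Product charts and the warped metric -/

section Warped

variable {E : Type*} [NormedAddCommGroup E] [NormedSpace ℝ E]
  {F : Type*} [TopologicalSpace F] [ChartedSpace E F] [IsManifold 𝓘(ℝ, E) ∞ F]
  {J : TopologicalSpace.Opens ℝ}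

theorem extChartAt_opens (s t : J) : extChartAt 𝓘(ℝ, ℝ) s t = t := by
  simp [TopologicalSpace.Opens.chartAt_eq]
  rfl

theorem extChartAt_opens_source (s : J) : (extChartAt 𝓘(ℝ, ℝ) s).source = Set.univ := by
  simp [TopologicalSpace.Opens.chartAt_eq, OpenPartialHomeomorph.subtypeRestr]
  exact fun _ _ => trivial

theorem extChartAt_opens_target_subset (s : J) : (extChartAt 𝓘(ℝ, ℝ) s).target ⊆ J := by
  intro t ht
  rw [← (extChartAt 𝓘(ℝ, ℝ) s).right_inv ht, extChartAt_opens]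
  exact Subtype.mem _

/-- Every preferred chart of the open set J is the inclusion into ℝ, so the transition is the
identity in the base direction. -/
theorem tangentCoordChange_prod {p q r : J × F}
    (hp : r.2 ∈ (extChartAt 𝓘(ℝ, E) p.2).source) (hq : r.2 ∈ (extChartAt 𝓘(ℝ, E) q.2).source)
    (v : ℝ × E) :
    tangentCoordChange (𝓘(ℝ, ℝ).prod 𝓘(ℝ, E)) p q r v =
      (v.1, tangentCoordChange 𝓘(ℝ, E) p.2 q.2 r.2 v.2) := by
  have hJ : ∀ s : J, r.1 ∈ (extChartAt 𝓘(ℝ, ℝ) s).source := fun s => by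
    rw [extChartAt_opens_source]; trivial
  have h1 := hasFDerivAt_tangentCoordChange (I := 𝓘(ℝ, ℝ).prod 𝓘(ℝ, E)) (x := p) (y := q) (z := r)
    (by simp only [extChartAt_prod, PartialEquiv.prod_source]; exact ⟨⟨hJ _, hp⟩, ⟨hJ _, hq⟩⟩)
  have h2 : HasFDerivAt (extChartAt 𝓘(ℝ, ℝ) q.1 ∘ (extChartAt 𝓘(ℝ, ℝ) p.1).symm)
      (ContinuousLinearMap.id ℝ ℝ) (extChartAt 𝓘(ℝ, ℝ) p.1 r.1) := by
    refine (hasFDerivAt_id _).congr_of_eventuallyEq ?_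
    filter_upwards [(isOpen_extChartAt_target (I := 𝓘(ℝ, ℝ)) p.1).mem_nhds
      ((extChartAt 𝓘(ℝ, ℝ) p.1).map_source (hJ _))] with t ht
    have := (extChartAt 𝓘(ℝ, ℝ) p.1).right_inv ht
    rw [extChartAt_opens] at this
    rw [Function.comp_apply, extChartAt_opens, this, id]
  have h3 := hasFDerivAt_tangentCoordChange (I := 𝓘(ℝ, E)) ⟨hp, hq⟩
  have h4 := HasFDerivAt.prodMap (p := extChartAt (𝓘(ℝ, ℝ).prod 𝓘(ℝ, E)) p r) h2 h3
  have h5 : (extChartAt (𝓘(ℝ, ℝ).prod 𝓘(ℝ, E)) q) ∘ (extChartAt (𝓘(ℝ, ℝ).prod 𝓘(ℝ, E)) p).symm =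
      Prod.map (extChartAt 𝓘(ℝ, ℝ) q.1 ∘ (extChartAt 𝓘(ℝ, ℝ) p.1).symm)
        (extChartAt 𝓘(ℝ, E) q.2 ∘ (extChartAt 𝓘(ℝ, E) p.2).symm) := by
    simp only [extChartAt_prod]
    rfl
  rw [h5] at h1
  rw [h1.unique h4]
  rfl

variable [FiniteDimensional ℝ E] {ε : ℝ} {f : ℝ → ℝ} {gF : BilinField 𝓘(ℝ, E) F}

theorem modelForm_warpedMetric (ε : ℝ) (f : ℝ → ℝ) (gF : BilinField 𝓘(ℝ, E) F) (q : J × F)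
    (v w : ℝ × E) : modelForm (warpedMetric J ε f gF q) v w =
      ε * (v.1 * w.1) + f q.1 ^ 2 * modelForm (gF q.2) v.2 w.2 := rfl

/-- Because base coordinates never change, one product chart exhibits the warped form at all points
of its target, as differentiation requires. -/
theorem isWarpedOn_inChart (hgF : IsSemiRiemannianMetric gF) (hf : ContDiffOn ℝ ∞ f J)
    (hfpos : ∀ t ∈ J, 0 < f t) (hε : ε = 1 ∨ ε = -1) (q : J × F) :
    CoordGeom.IsWarpedOn (inChart (warpedMetric J ε f gF) q) ε f (inChart gF q.2)
      (extChartAt 𝓘(ℝ, ℝ) q.1).target (extChartAt 𝓘(ℝ, E) q.2).target where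
  isOpen := isOpen_extChartAt_target q.1
  smooth := hf.mono (extChartAt_opens_target_subset q.1)
  pos := fun t ht => hfpos t (extChartAt_opens_target_subset q.1 ht)
  sign := hε
  fiber := isMetricOn_inChart hgF q.2
  eq := fun t ht x hx v w => by
    have hy : (t, x) ∈ (extChartAt (𝓘(ℝ, ℝ).prod 𝓘(ℝ, E)) q).target := by
      simp only [extChartAt_prod, PartialEquiv.prod_target]
      exact ⟨ht, hx⟩
    have hq : (extChartAt (𝓘(ℝ, ℝ).prod 𝓘(ℝ, E)) q).symm (t, x) =
        ((extChartAt 𝓘(ℝ, ℝ) q.1).symm t, (extChartAt 𝓘(ℝ, E) q.2).symm x) := by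
      simp only [extChartAt_prod]
      rfl
    have ht' : (((extChartAt 𝓘(ℝ, ℝ) q.1).symm t : J) : ℝ) = t := by
      rw [← extChartAt_opens q.1, (extChartAt 𝓘(ℝ, ℝ) q.1).right_inv ht]
    have hs := (extChartAt 𝓘(ℝ, E) q.2).map_target hx
    rw [inChart_apply _ q hy hq, tangentCoordChange_prod hs (mem_extChartAt_source _),
      tangentCoordChange_prod hs (mem_extChartAt_source _), inChart_apply gF q.2 hx rfl]
    rw [modelForm_warpedMetric, ht']

theorem extChartAt_prod_self (q : J × F) : extChartAt (𝓘(ℝ, ℝ).prod 𝓘(ℝ, E)) q q =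
    ((q.1 : ℝ), extChartAt 𝓘(ℝ, E) q.2 q.2) := by
  simp only [extChartAt_prod]
  exact Prod.ext (extChartAt_opens q.1 q.1) rfl

theorem mem_extChartAt_opens_target (s : J) : (s : ℝ) ∈ (extChartAt 𝓘(ℝ, ℝ) s).target := by
  have := mem_extChartAt_target (I := 𝓘(ℝ, ℝ)) s
  rwa [extChartAt_opens] at this

/-- In the trivialization at q the field has the constant components (1, 0). -/
theorem isSmoothField_liftDt : IsSmoothField (liftDt (E := E) J F) := by
  intro q
  rw [Bundle.contMDiffAt_section]
  have hc : ContMDiffAt (𝓘(ℝ, ℝ).prod 𝓘(ℝ, E)) 𝓘(ℝ, ℝ × E) ∞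
      (fun _ : J × F => ((1, 0) : ℝ × E)) q := contMDiffAt_const
  refine hc.congr_of_eventuallyEq ?_
  filter_upwards [(isOpen_extChartAt_source (I := 𝓘(ℝ, ℝ).prod 𝓘(ℝ, E)) q).mem_nhds
    (mem_extChartAt_source q)] with r hr
  have hr2 : r.2 ∈ (extChartAt 𝓘(ℝ, E) q.2).source := by
    simp only [extChartAt_prod, PartialEquiv.prod_source] at hr
    exact hr.2
  have := tangentCoordChange_prod (p := r) (q := q) (r := r) (mem_extChartAt_source _) hr2 (1, 0)
  rw [map_zero] at this
  exact this

end Warped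

end SemiRiem

/-! ### The hypotheses force an Einstein fibre; conclusions for such a fibre -/

namespace SemiRiem

section Warped

variable {E : Type*} [NormedAddCommGroup E] [NormedSpace ℝ E] [FiniteDimensional ℝ E]
  {F : Type*} [TopologicalSpace F] [ChartedSpace E F] [IsManifold 𝓘(ℝ, E) ∞ F]
  {J : TopologicalSpace.Opens ℝ} {ε : ℝ} {f : ℝ → ℝ} {gF : BilinField 𝓘(ℝ, E) F}

theorem exists_ricciAt_eq_of_tfRicci {p : F}
    (h : ∀ v w : E, CoordGeom.tfRicci (inChart gF p) (extChartAt 𝓘(ℝ, E) p p) v w = 0) :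
    ∃ r : ℝ, ∀ v w, ricciAt gF p v w = r * gF p v w := by
  have key : ∀ v w : E, CoordGeom.ricci (inChart gF p) (extChartAt 𝓘(ℝ, E) p p) v w =
      CoordGeom.scalar (inChart gF p) (extChartAt 𝓘(ℝ, E) p p) / Module.finrank ℝ E *
        modelForm (gF p) v w := fun v w => by
    have h1 := h v w
    rwa [CoordGeom.tfRicci, inChart_base, sub_eq_zero] at h1
  exact ⟨_, key⟩

/-- The electric part of W is −ε/(m − 1) times the trace-free Ricci tensor of the fibre. -/
theorem exists_ricciAt_eq_of_electric (hgF : IsSemiRiemannianMetric gF)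
    (hf : ContDiffOn ℝ ∞ f J) (hfpos : ∀ t ∈ J, 0 < f t) (hε : ε = 1 ∨ ε = -1)
    (hm : 2 ≤ Module.finrank ℝ E) (h : ElectricPartVanishes J ε f gF) (q : J × F) :
    ∃ r : ℝ, ∀ v w, ricciAt gF q.2 v w = r * gF q.2 v w := by
  have hW := isWarpedOn_inChart hgF hf hfpos hε q
  have ht := mem_extChartAt_opens_target q.1
  have hx := mem_extChartAt_target (I := 𝓘(ℝ, E)) q.2
  refine exists_ricciAt_eq_of_tfRicci fun v w => ?_
  have h1 := hW.weylLow_eq hm ht hx (0, v) (1, 0) (1, 0) (0, w)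
  have h2 : CoordGeom.weylLow (inChart (warpedMetric J ε f gF) q)
      ((q.1 : ℝ), extChartAt 𝓘(ℝ, E) q.2 q.2) ![(0, v), (1, 0), (1, 0), (0, w)] = 0 := by
    have h3 := h q v w
    have h4 := inChart_base (warpedMetric J ε f gF) q
      (CoordGeom.weyl (inChart (warpedMetric J ε f gF) q)
        (extChartAt (𝓘(ℝ, ℝ).prod 𝓘(ℝ, E)) q q) (0, v) (1, 0) (1, 0)) (0, w)
    rw [extChartAt_prod_self] at h4
    refine h4.trans ?_
    rw [← extChartAt_prod_self]
    exact h3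
  have hA : CoordGeom.cylWeyl (inChart gF q.2) (extChartAt 𝓘(ℝ, E) q.2 q.2) v 0 0 w = 0 := by
    have hr := CoordGeom.isBilin_ricci hW.fiber hx
    simp only [CoordGeom.cylWeyl, map_zero, zero_apply, hr.zero_left, hr.zero_right]
    ring
  rw [h2] at h1
  have hm' : (2 : ℝ) ≤ Module.finrank ℝ E := by exact_mod_cast hm
  have hm1 : (Module.finrank ℝ E : ℝ) - 1 ≠ 0 := by linarith
  have hε0 : ε ≠ 0 := by rcases hε with h | h <;> simp [h]
  simp only [hA] at h1
  simpa [hε0, hm1] using h1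

theorem exists_deriv_ne_zero (hJ : (J : Set ℝ).OrdConnected) (hf : ContDiffOn ℝ ∞ f J)
    (h : ∃ s ∈ J, ∃ t ∈ J, f s ≠ f t) : ∃ t ∈ J, deriv f t ≠ 0 := by
  obtain ⟨s, hs, t, ht, hst⟩ := h
  by_contra! h0
  refine hst (J.isOpen.is_const_of_deriv_eq_zero hJ.isPreconnected
    (hf.differentiableOn (by simp)) (fun t ht => h0 t ht) hs ht)

/-- In `divWeyl_eq` the factor of the trace-free Ricci tensor is nonzero, since m ≥ 3 and f'(t) ≠ 0
at the given point. -/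
theorem exists_ricciAt_eq_of_harmonic (hgF : IsSemiRiemannianMetric gF)
    (hf : ContDiffOn ℝ ∞ f J) (hfpos : ∀ t ∈ J, 0 < f t) (hε : ε = 1 ∨ ε = -1)
    (hm : 3 ≤ Module.finrank ℝ E) (h : HasHarmonicWeyl (warpedMetric J ε f gF)) (q : J × F)
    (hq : deriv f q.1 ≠ 0) :
    ∃ r : ℝ, ∀ v w, ricciAt gF q.2 v w = r * gF q.2 v w := by
  have hW := isWarpedOn_inChart hgF hf hfpos hε q
  have ht := mem_extChartAt_opens_target q.1
  have hx := mem_extChartAt_target (I := 𝓘(ℝ, E)) q.2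
  refine exists_ricciAt_eq_of_tfRicci fun v w => ?_
  have h1 := hW.divWeyl_eq (by omega) ht hx v w
  have h2 : CoordGeom.divWeyl (inChart (warpedMetric J ε f gF) q)
      ((q.1 : ℝ), extChartAt 𝓘(ℝ, E) q.2 q.2) (1, 0) (0, v) (0, w) = 0 := by
    rw [← extChartAt_prod_self]
    exact h q (1, 0) (0, v) (0, w)
  rw [h2] at h1
  have hm' : (3 : ℝ) ≤ Module.finrank ℝ E := by exact_mod_cast hm
  have hm1 : (Module.finrank ℝ E : ℝ) - 1 ≠ 0 := by linarith
  have hm2 : 2 - (Module.finrank ℝ E : ℝ) ≠ 0 := by linarith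
  have hf0 := hW.ne_zero ht
  simpa [hm1, hm2, hf0, hq] using h1

/-- Near q the function depends on t alone, so k needs no regularity in its first argument. -/
theorem contMDiff_of_locally_eq {r : F → ℝ} (hr : ∀ p, ∀ᶠ q in 𝓝 p, r q = r p)
    {k : ℝ → ℝ → ℝ} (hk : ∀ c, ContDiffOn ℝ ∞ (k c) J) :
    ContMDiff (𝓘(ℝ, ℝ).prod 𝓘(ℝ, E)) 𝓘(ℝ, ℝ) ∞ fun q : J × F => k (r q.2) q.1 := by
  intro q
  have h1 : ContMDiffAt 𝓘(ℝ, ℝ) 𝓘(ℝ, ℝ) ∞ (k (r q.2)) (q.1 : ℝ) :=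
    ((hk (r q.2)).contDiffAt (J.isOpen.mem_nhds q.1.2)).contMDiffAt
  have h2 : ContMDiff (𝓘(ℝ, ℝ).prod 𝓘(ℝ, E)) 𝓘(ℝ, ℝ) ∞ fun q : J × F => (q.1 : ℝ) :=
    contMDiff_subtype_val.comp contMDiff_fst
  refine (h1.comp q (h2 q)).congr_of_eventuallyEq ?_
  filter_upwards [continuousAt_snd.eventually (hr q.2)] with q' hq'
  simp only [Function.comp_apply]
  rw [hq']

theorem contDiffOn_ricciFactor (hf : ContDiffOn ℝ ∞ f J) (hfpos : ∀ t ∈ J, 0 < f t) (m r : ℝ) :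
    ContDiffOn ℝ ∞ (CoordGeom.ricciFactor m ε f r) J := by
  have h1 : ContDiffOn ℝ ∞ (deriv f) J := hf.deriv_of_isOpen J.isOpen (by simp)
  have h2 : ContDiffOn ℝ ∞ (deriv (deriv f)) J := h1.deriv_of_isOpen J.isOpen (by simp)
  exact (contDiffOn_const.sub (contDiffOn_const.mul ((hf.mul h2).add
    (contDiffOn_const.mul (h1.pow 2))))).div (hf.pow 2) fun t ht => (pow_pos (hfpos t ht) 2).ne'

theorem modelForm_warpedMetric_dt (q : J × F) (v : ℝ × E) :
    modelForm (warpedMetric J ε f gF q) (1, 0) v = ε * v.1 := by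
  rw [modelForm_warpedMetric]
  simp

/-- The conclusions of the theorem for a fibre whose Ricci tensor is pointwise a multiple of the
metric. -/
theorem warpedMetric_of_pointwise_einstein (hgF : IsSemiRiemannianMetric gF)
    (hf : ContDiffOn ℝ ∞ f J) (hfpos : ∀ t ∈ J, 0 < f t) (hε : ε = 1 ∨ ε = -1)
    (hm : 3 ≤ Module.finrank ℝ E) {r : F → ℝ}
    (hr : ∀ p v w, ricciAt gF p v w = r p * gF p v w) :
    IsWeaklyConformallyFlatWith (warpedMetric J ε f gF) (liftDt J F) ∧
      IsQuasiEinsteinWith (warpedMetric J ε f gF) (liftDt J F) ∧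
      ∀ κ, IsBachFlat κ (warpedMetric J ε f gF) := by
  have hW := isWarpedOn_inChart hgF hf hfpos hε
  have ht := fun q : J × F => mem_extChartAt_opens_target q.1
  have hx := fun q : J × F => mem_extChartAt_target (I := 𝓘(ℝ, E)) q.2
  have hE := fun q : J × F => ricci_inChart_of_pointwise hgF hr q.2
  have hloc := eventually_eq_of_pointwise hgF hr hm
  refine ⟨⟨isSmoothField_liftDt, fun q hq => ?_, fun q u v => ?_⟩, ⟨isSmoothField_liftDt, ?_,
    fun q => CoordGeom.ricciFactor (Module.finrank ℝ E) ε f (r q.2) q.1,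
    fun q => -(Module.finrank ℝ E * (deriv (deriv f) q.1 / f q.1))
        - ε * CoordGeom.ricciFactor (Module.finrank ℝ E) ε f (r q.2) q.1, ?_, ?_,
        fun q v w => ?_⟩, fun κ q a b => ?_⟩
  · have : ((1, 0) : ℝ × E) = 0 := hq
    simp at this
  · have := (hW q).weyl_dt (by omega) (hE q) (ht q) (hx q) u v
    rw [← extChartAt_prod_self] at this
    exact this
  · have h1 : ∀ q : J × F, warpedMetric J ε f gF q (liftDt J F q) (liftDt J F q) = ε := fun q =>
      (modelForm_warpedMetric_dt q (1, 0)).trans (mul_one ε)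
    rcases hε with h | h
    · exact Or.inl fun q => (h1 q).trans h
    · exact Or.inr fun q => (h1 q).trans h
  · exact contMDiff_of_locally_eq hloc fun c => contDiffOn_ricciFactor hf hfpos _ c
  · refine contMDiff_of_locally_eq (k := fun c t => -(Module.finrank ℝ E *
      (deriv (deriv f) t / f t)) - ε * CoordGeom.ricciFactor (Module.finrank ℝ E) ε f c t)
      hloc fun c => ?_
    have h1 : ContDiffOn ℝ ∞ (deriv f) J := hf.deriv_of_isOpen J.isOpen (by simp)
    have h2 : ContDiffOn ℝ ∞ (deriv (deriv f)) J := h1.deriv_of_isOpen J.isOpen (by simp)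
    exact (contDiffOn_const.mul (h2.div hf fun t ht => (hfpos t ht).ne')).neg.sub
      (contDiffOn_const.mul (contDiffOn_ricciFactor hf hfpos _ c))
  · have key : ∀ v w : ℝ × E, CoordGeom.ricci (inChart (warpedMetric J ε f gF) q)
        (extChartAt (𝓘(ℝ, ℝ).prod 𝓘(ℝ, E)) q q) v w =
        CoordGeom.ricciFactor (Module.finrank ℝ E) ε f (r q.2) q.1 *
          modelForm (warpedMetric J ε f gF q) v w
        + (-(Module.finrank ℝ E * (deriv (deriv f) q.1 / f q.1))
          - ε * CoordGeom.ricciFactor (Module.finrank ℝ E) ε f (r q.2) q.1) *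
          (modelForm (warpedMetric J ε f gF q) (1, 0) v *
            modelForm (warpedMetric J ε f gF q) (1, 0) w) := fun v w => by
      have h1 := (hW q).ricci_of_einstein (ht q) (hx q)
        (r := r q.2) (fun v w => by
          rw [hE q _ (hx q), (extChartAt 𝓘(ℝ, E) q.2).left_inv (mem_extChartAt_source q.2)]) v w
      rw [← extChartAt_prod_self, inChart_base] at h1
      -- Here u = ε dt, hence u ⊗ u = dt ⊗ dt.
      rw [h1, modelForm_warpedMetric_dt, modelForm_warpedMetric_dt, mul_mul_mul_comm,
        (hW q).sq_sign, one_mul]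
    exact key v w
  · have := (hW q).bach_eq_zero hm (hE q) (ht q) (hx q) κ a b
    rw [← extChartAt_prod_self] at this
    exact this

end Warped

end SemiRiem

end

/-! ### Proof of the theorem -/

theorem theorem1p1 {E : Type*} [NormedAddCommGroup E] [NormedSpace ℝ E] [FiniteDimensional ℝ E]
    {F : Type*} [TopologicalSpace F] [ChartedSpace E F] [IsManifold 𝓘(ℝ, E) ∞ F]
    (n : ℕ) (hn : 4 ≤ n) (hdim : Module.finrank ℝ E + 1 = n)
    (gF : SemiRiem.BilinField 𝓘(ℝ, E) F) (hgF : SemiRiem.IsSemiRiemannianMetric gF)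
    (J : TopologicalSpace.Opens ℝ) (hJ : (J : Set ℝ).OrdConnected)
    (f : ℝ → ℝ) (hf : ContDiffOn ℝ ∞ f J) (hfpos : ∀ t ∈ J, 0 < f t)
    (ε : ℝ) (hε : ε = 1 ∨ ε = -1)
    (h : SemiRiem.IsEinstein gF ∨
      SemiRiem.ElectricPartVanishes J ε f gF ∨
      ((∃ s ∈ J, ∃ t ∈ J, f s ≠ f t) ∧
        SemiRiem.HasHarmonicWeyl (SemiRiem.warpedMetric J ε f gF))) :
    SemiRiem.IsWeaklyConformallyFlatWith (SemiRiem.warpedMetric J ε f gF)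
        (SemiRiem.liftDt J F) ∧
      SemiRiem.IsQuasiEinsteinWith (SemiRiem.warpedMetric J ε f gF) (SemiRiem.liftDt J F) ∧
      SemiRiem.IsBachFlat (1 / ((n : ℝ) - 3)) (SemiRiem.warpedMetric J ε f gF) ∧
      SemiRiem.IsBachFlat (1 / ((n : ℝ) - 1)) (SemiRiem.warpedMetric J ε f gF) := by
  have hm : 3 ≤ Module.finrank ℝ E := by omega
  -- Over an empty J the conclusions are vacuous, while the electric and harmonic hypotheses would
  -- say nothing about the fibre. A point t₀ lets the electric condition be read above every p.
  rcases isEmpty_or_nonempty J with hJe | ⟨⟨t₀⟩⟩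
  · have he : ∀ q : J × F, False := fun q => hJe.false q.1
    exact ⟨⟨fun q => (he q).elim, fun q => (he q).elim, fun q => (he q).elim⟩,
      ⟨fun q => (he q).elim, Or.inl fun q => (he q).elim, fun _ => 0, fun _ => 0,
        contMDiff_const, contMDiff_const, fun q => (he q).elim⟩,
      fun q => (he q).elim, fun q => (he q).elim⟩
  have hpt : ∀ p : F, ∃ r : ℝ, ∀ v w, SemiRiem.ricciAt gF p v w = r * gF p v w := by
    intro p
    rcases h with ⟨Λ, hΛ⟩ | h | ⟨hne, h⟩
    · exact ⟨Λ, hΛ p⟩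
    · exact SemiRiem.exists_ricciAt_eq_of_electric hgF hf hfpos hε (by omega) h (t₀, p)
    -- The same t serves all p, since the Ricci tensor of the fibre does not involve t.
    · obtain ⟨t, ht, hd⟩ := SemiRiem.exists_deriv_ne_zero hJ hf hne
      exact SemiRiem.exists_ricciAt_eq_of_harmonic hgF hf hfpos hε hm h (⟨t, ht⟩, p) hd
  choose r hr using hpt
  obtain ⟨h1, h2, h3⟩ :=
    SemiRiem.warpedMetric_of_pointwise_einstein hgF hf hfpos hε hm hr
  exact ⟨h1, h2, h3 _, h3 _⟩
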